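/- Let $p\ge 3$ be a prime, let $e\ge 1$, and let $K_{p[p^e]}$ be the complete multipartite graph with $p$ parts of $p^e$ vertices each. Let $\mathcal M$ be an orientably-regular embedding of $K_{p[p^e]}$, that is, an oriented map with underlying graph $K_{p[p^e]}$ whose group $G=\mathrm{Aut}^+(\mathcal M)$ of orientation-preserving automorphisms acts regularly on the arcs. Let $H=\mathrm{Aut}^+_0(\mathcal M)$ be the normal subgroup of $G$ consisting of the automorphisms that preserve each part setwise, and let $P$ be a Sylow $p$-subgroup of $G$. For $1\le f\le e$ put $$H_{p,e,f}=\langle x,z\mid x^{p^{e}}=z^{p^{e}}=1,\ z^{x}=z^{1+p^{f}}\rangle ,\qquad z^x=x^{-1}zx .$$ Suppose that $H$ is nonabelian and that $P$ has exponent $p^e$. Then $p=3$, $e\ge 2$ and $H\cong H_{p,e,e-1}$; moreover $f=e-1$ is the only $f\in\{1,\dots,e\}$ with $H\cong H_{p,e,f}$. -/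

import Mathlib

/-- An oriented map with underlying graph `Γ`: a 2-cell embedding of the connected graph `Γ` in an
oriented closed surface, given by its rotation system (local rotation). `rot` sends each arc to the
next one, in the positive sense, around the same initial vertex, so the arcs starting at a given
vertex form a single cycle of `rot`. -/
structure OrientedMap {V : Type*} (Γ : SimpleGraph V) where
  connected : Γ.Connected
  rot : Equiv.Perm Γ.Dart
  rot_fst : ∀ d : Γ.Dart, (rot d).fst = d.fst
  rot_cyclic : ∀ d d' : Γ.Dart, d.fst = d'.fst → rot.SameCycle d d'

namespace OrientedMap

/-- The group `Aut⁺(M)` of orientation-preserving automorphisms of the map: the automorphisms of the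
underlying graph whose action on arcs commutes with the local rotation. -/
def autPlus {V : Type*} {Γ : SimpleGraph V} (M : OrientedMap Γ) : Subgroup (Γ ≃g Γ) where
  carrier := {φ | ∀ d : Γ.Dart, φ.toHom.mapDart (M.rot d) = M.rot (φ.toHom.mapDart d)}
  one_mem' := fun _ => rfl
  mul_mem' := by
    intro φ ψ hφ hψ d
    have h := hφ (ψ.toHom.mapDart d)
    rw [← hψ d] at h
    exact h
  inv_mem' := by
    intro φ hφ d
    have key : ∀ c : Γ.Dart, φ.toHom.mapDart ((φ⁻¹ : Γ ≃g Γ).toHom.mapDart c) = c := by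
      intro c
      apply SimpleGraph.Dart.ext
      exact Prod.ext (φ.apply_symm_apply c.fst) (φ.apply_symm_apply c.snd)
    have key' : ∀ c : Γ.Dart, (φ⁻¹ : Γ ≃g Γ).toHom.mapDart (φ.toHom.mapDart c) = c := by
      intro c
      apply SimpleGraph.Dart.ext
      exact Prod.ext (φ.symm_apply_apply c.fst) (φ.symm_apply_apply c.snd)
    have h := hφ ((φ⁻¹ : Γ ≃g Γ).toHom.mapDart d)
    rw [key] at h
    rw [← h, key']

/-- The map is orientably-regular: `Aut⁺(M)` acts regularly on the arcs. -/
def IsOrientablyRegular {V : Type*} {Γ : SimpleGraph V} (M : OrientedMap Γ) : Prop :=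
  ∀ d d' : Γ.Dart, ∃! φ : M.autPlus, (φ : Γ ≃g Γ).toHom.mapDart d = d'

/-- The subgroup `Aut⁺₀(M)` of `Aut⁺(M)` for a map whose underlying graph is the complete
multipartite graph with `m` parts of size `n`: the orientation-preserving automorphisms preserving
each part setwise (the part of a vertex is its first coordinate). -/
def autPlusZero {m n : ℕ} (M : OrientedMap (SimpleGraph.completeEquipartiteGraph m n)) :
    Subgroup M.autPlus where
  carrier := {φ | ∀ v : Fin m × Fin n, (φ.val v).1 = v.1}
  one_mem' := fun _ => rfl
  mul_mem' := by
    intro φ ψ hφ hψ v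
    exact (hφ (ψ.val v)).trans (hψ v)
  inv_mem' := by
    intro φ hφ v
    have h := hφ (φ.val.symm v)
    rw [RelIso.apply_symm_apply] at h
    exact h.symm

end OrientedMap

/-- The relators of `⟨x, z ∣ x ^ (p ^ e) = z ^ (p ^ e) = 1, z ^ x = z ^ (1 + p ^ f)⟩`, where `x`, `z`
are the generators `0`, `1` and `z ^ x = x⁻¹ z x`. -/
def metacyclicRels (p e f : ℕ) : Set (FreeGroup (Fin 2)) :=
  {FreeGroup.of 0 ^ p ^ e,
   FreeGroup.of 1 ^ p ^ e,
   (FreeGroup.of 0)⁻¹ * FreeGroup.of 1 * FreeGroup.of 0 * (FreeGroup.of 1 ^ (1 + p ^ f))⁻¹}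

/-- The group `⟨x, z ∣ x ^ (p ^ e) = z ^ (p ^ e) = 1, z ^ x = z ^ (1 + p ^ f)⟩`. -/
abbrev MetacyclicGroup (p e f : ℕ) : Type := PresentedGroup (metacyclicRels p e f)

/-! A Sylow `p`-subgroup `P` contains `H` with index `p`. Take `g ∈ P \ H` and a vertex `v` that `g`
moves to another part. The stabilizer of `v` in `H` is cyclic of order `p ^ e`, generated by some
`x`, and `y = g x g⁻¹` generates the stabilizer of `g v`. Since `H` acts regularly on the product of
the two parts, `H = ⟨x⟩⟨y⟩` with trivial intersection (`OrientedMap.exists_isBicyclic`).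

Write `H_i` for `agemoIter p H i`. Each `H_i` is again such a product, of `⟨x ^ p ^ i⟩` and `⟨y ^ p
^ i⟩` (`IsBicyclic.iterate`), so every layer `H_i / H_{i+1}` with `i < e` has order `p ^ 2`. It
follows that `H` centralizes each layer, and that `H_1` centralizes `H_i` modulo `H_{i+2}`. The
exponent hypothesis gives `(g ^ p) ^ p ^ (e - 1) = 1`, which for odd `p` forces `g ^ p ∈ H_1`.

Put `X = x ^ p ^ i` and let `Z`, `W`, `V` be the successive commutators of `X` with `g`. As `g ^ p`
centralizes `X` modulo `H_{i+2}`, the binomial expansion of its action reads `Z ^ p * W ^ (p choose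
2) * V ^ (p choose 3) = 1`. The `W` factor vanishes but `Z ^ p` does not, so `p = 3` and `V ≠ 1`
there (`IsBicyclic.eq_three_and_notMem`).

Let `c = ⁅x, y⁆`. If `c` lay in `H_f` but not in `H_{f+1}` for some `1 ≤ f ≤ e - 2`, then modulo
`H_{f+2}` it would generate a `g`-invariant cyclic subgroup, which is incompatible with `V ≠ 1`.
Hence `c ∈ H_{e-1}` (`IsBicyclic.commutator_mem_agemoIter`). So `c` is central in `H`, of order `p`,
and equals `z ^ p ^ (e - 1)` for some `z`; a suitable power of `x` or `y` conjugates `z` to `z * c`,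
which is the required presentation. Abelianizations distinguish the parameters `f`. -/

open scoped commutatorElement

/-! ### Commutator calculus in class two. -/

section ClassTwo

variable {G : Type*} [Group G] {x y c : G}

theorem zpow_mul_zpow_eq_of_commutes (h : x * y = c * (y * x)) (hx : Commute c x)
    (hy : Commute c y) (j k : ℤ) : x ^ k * y ^ j = y ^ j * x ^ k * c ^ (k * j) := by
  have h1 : SemiconjBy y x (c⁻¹ * x) := by
    have : y * x = c⁻¹ * (x * y) := by rw [h]; group
    rw [SemiconjBy, this, mul_assoc]
  have h2 := h1.zpow_right k
  rw [hx.inv_left.mul_zpow] at h2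
  have h3 : SemiconjBy (x ^ k) y (c ^ k * y) := by
    have h2' : y * x ^ k = c⁻¹ ^ k * x ^ k * y := h2
    have : x ^ k * y = c ^ k * (y * x ^ k) := by rw [h2']; group
    rw [SemiconjBy, this, mul_assoc]
  have h4 := h3.zpow_right j
  rw [(hy.zpow_left k).mul_zpow, ← zpow_mul] at h4
  have h5 : x ^ k * y ^ j = c ^ (k * j) * y ^ j * x ^ k := h4
  have h6 : Commute (c ^ (k * j)) (y ^ j * x ^ k) :=
    ((hy.zpow_right j).mul_right (hx.zpow_right k)).zpow_left _
  rw [h5, mul_assoc, h6.eq]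

/-- Collecting the powers of `x` on the left takes `n.choose 2` exchanges of a `y ^ j` with an `x ^
i`, each costing a factor `c ^ (-(i * j))`. -/
theorem mul_pow_of_commutes (h : x * y = c * (y * x)) (hx : Commute c x)
    (hy : Commute c y) (i j : ℤ) (n : ℕ) :
    (x ^ i * y ^ j) ^ n = x ^ (i * n) * y ^ (j * n) * c ^ (-(i * j * (n.choose 2 : ℤ))) := by
  induction n with
  | zero => simp
  | succ n ih =>
    have h1 := zpow_mul_zpow_eq_of_commutes h hx hy (j * n) i
    have h2 : y ^ (j * (n : ℤ)) * x ^ i = x ^ i * y ^ (j * (n : ℤ)) * c ^ (-(i * (j * n))) := by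
      rw [h1]; group
    have cc : ∀ m : ℤ, Commute (c ^ m) (x ^ i * y ^ j) := fun m =>
      ((hx.zpow_right i).mul_right (hy.zpow_right j)).zpow_left _
    have ccy : ∀ m : ℤ, Commute (c ^ m) (y ^ j) := fun m => (hy.zpow_right j).zpow_left _
    rw [pow_succ, ih, mul_assoc, (cc _).eq]
    calc x ^ (i * (n : ℤ)) * y ^ (j * (n : ℤ)) * (x ^ i * y ^ j * c ^ (-(i * j * (n.choose 2 : ℤ))))
        = x ^ (i * (n : ℤ)) * (y ^ (j * (n : ℤ)) * x ^ i) * y ^ j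
            * c ^ (-(i * j * (n.choose 2 : ℤ))) := by group
      _ = x ^ (i * (n : ℤ)) * x ^ i * y ^ (j * (n : ℤ)) * (c ^ (-(i * (j * n))) * y ^ j)
            * c ^ (-(i * j * (n.choose 2 : ℤ))) := by rw [h2]; group
      _ = x ^ (i * (n : ℤ)) * x ^ i * (y ^ (j * (n : ℤ)) * y ^ j) * (c ^ (-(i * (j * n)))
            * c ^ (-(i * j * (n.choose 2 : ℤ)))) := by rw [(ccy _).eq]; group
      _ = _ := by
        rw [← zpow_add, ← zpow_add, ← zpow_add, Nat.choose_succ_succ' n 1]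
        congr 3
        · push_cast; ring
        · push_cast; ring
        · push_cast; simp; ring

/-- The commutator is bilinear in the exponents: it is `c` to the determinant `i * l - k * j`. -/
theorem commutator_mem_zpowers_of_commutes (h : x * y = c * (y * x)) (hx : Commute c x)
    (hy : Commute c y) {a b : G} (ha : ∃ i j : ℤ, a = x ^ i * y ^ j)
    (hb : ∃ i j : ℤ, b = x ^ i * y ^ j) : ⁅a, b⁆ ∈ Subgroup.zpowers c := by
  obtain ⟨i, j, rfl⟩ := ha
  obtain ⟨k, l, rfl⟩ := hb
  have cy : ∀ m n : ℤ, Commute (c ^ m) (y ^ n) := fun m n => (hy.zpow_right n).zpow_left _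
  have key : ∀ i j k l : ℤ, x ^ i * y ^ j * (x ^ k * y ^ l)
      = x ^ (i + k) * y ^ (j + l) * c ^ (-(k * j)) := by
    intro i j k l
    have h2 : y ^ j * x ^ k = x ^ k * y ^ j * c ^ (-(k * j)) := by
      rw [zpow_mul_zpow_eq_of_commutes h hx hy j k]; group
    calc x ^ i * y ^ j * (x ^ k * y ^ l) = x ^ i * (y ^ j * x ^ k) * y ^ l := by group
      _ = x ^ i * x ^ k * y ^ j * (c ^ (-(k * j)) * y ^ l) := by rw [h2]; group
      _ = _ := by rw [(cy _ _).eq, zpow_add, zpow_add]; group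
  have h1 := key i j k l
  have h2 := key k l i j
  have h3 : x ^ i * y ^ j * (x ^ k * y ^ l)
      = x ^ k * y ^ l * (x ^ i * y ^ j) * c ^ (i * l - k * j) := by
    rw [h1, h2, mul_assoc _ (c ^ _) (c ^ _), ← zpow_add, add_comm i k, add_comm j l]
    congr 2; ring
  have cc : ∀ m : ℤ, Commute (c ^ m) (x ^ k * y ^ l * (x ^ i * y ^ j)) := fun m =>
    (((hx.zpow_right k).mul_right (hy.zpow_right l)).mul_right
      ((hx.zpow_right i).mul_right (hy.zpow_right j))).zpow_left _
  rw [← (cc _).eq] at h3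
  refine ⟨i * l - k * j, ?_⟩
  change c ^ _ = _
  rw [commutatorElement_def, h3]
  group

end ClassTwo

/-! ### Small normal subgroups of finite `p`-groups. -/

section Nilpotent

/-- If `⁅M, ⊤⁆ = M`, then `M` lies in every term of the lower central series, which reaches `⊥`. -/
theorem Subgroup.commutator_top_lt {G : Type*} [Group G] [Group.IsNilpotent G] {M : Subgroup G}
    [M.Normal] (hM : M ≠ ⊥) : ⁅M, (⊤ : Subgroup G)⁆ < M := by
  refine lt_of_le_of_ne (Subgroup.commutator_le_left _ _) fun h => hM ?_
  obtain ⟨n, hn⟩ := Subgroup.nilpotent_iff_lowerCentralSeries.1 (inferInstance : Group.IsNilpotent G)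
  have : ∀ k, M ≤ (⊤ : Subgroup G).lowerCentralSeries k := by
    intro k
    induction k with
    | zero => simp
    | succ k ih =>
      rw [← h]
      exact Subgroup.commutator_mono ih le_rfl
  exact le_bot_iff.1 (hn ▸ this n)

theorem Subgroup.card_dvd_of_lt {G : Type*} [Group G] [Finite G] {p n : ℕ} [Fact p.Prime]
    {K M : Subgroup G} (h : K < M) (hM : Nat.card M ∣ p ^ (n + 1)) : Nat.card K ∣ p ^ n := by
  obtain ⟨m, hm, hm'⟩ := (Nat.dvd_prime_pow Fact.out).1 hM
  have h1 := Subgroup.card_dvd_of_le h.le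
  rw [hm'] at h1
  obtain ⟨k, hk, hk'⟩ := (Nat.dvd_prime_pow Fact.out).1 h1
  have : k ≠ m := by
    rintro rfl
    exact h.ne (Subgroup.eq_of_le_of_card_ge h.le (by rw [hk', hm']))
  rw [hk']
  exact pow_dvd_pow _ (by omega)

variable {P : Type*} [Group P] [Finite P] {p : ℕ} [Fact p.Prime]

theorem IsPGroup.card_commutator_top_dvd (hP : IsPGroup p P) {n : ℕ} {M : Subgroup P} [M.Normal]
    (hM : Nat.card M ∣ p ^ (n + 1)) : Nat.card ↥⁅M, (⊤ : Subgroup P)⁆ ∣ p ^ n := by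
  have := hP.isNilpotent
  by_cases h : M = ⊥
  · subst h; simp
  · exact Subgroup.card_dvd_of_lt (Subgroup.commutator_top_lt h) hM

theorem IsPGroup.commute_of_card_dvd (hP : IsPGroup p P) {M : Subgroup P} [M.Normal]
    (hM : Nat.card M ∣ p) {m : P} (hm : m ∈ M) (g : P) : Commute m g := by
  have h := hP.card_commutator_top_dvd (n := 0) (M := M) (by simpa using hM)
  rw [pow_zero, Nat.dvd_one, Subgroup.card_eq_one] at h
  have : ⁅m, g⁆ ∈ ⁅M, (⊤ : Subgroup P)⁆ := Subgroup.commutator_mem_commutator hm trivial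
  rw [h, Subgroup.mem_bot] at this
  exact commutatorElement_eq_one_iff_mul_comm.1 this

/-- Commutation with the whole group lowers the order by at least a factor `p`, so `⁅M, ⊤⁆` is
normal of order dividing `p`, hence central. -/
theorem IsPGroup.commute_commutator_of_card_dvd (hP : IsPGroup p P) {M : Subgroup P} [M.Normal]
    (hM : Nat.card M ∣ p ^ 2) {m : P} (hm : m ∈ M) (g h : P) : Commute ⁅m, g⁆ h := by
  have h1 := hP.card_commutator_top_dvd (n := 1) hM
  rw [pow_one] at h1
  exact hP.commute_of_card_dvd h1 (Subgroup.commutator_mem_commutator hm trivial) h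

/-- In a finite `p`-group, the commutator of two generators of a normal subgroup is central if it
commutes with both generators and has order dividing `p`. -/
theorem IsPGroup.commute_of_normal_of_pow_eq_one (hP : IsPGroup p P) {H : Subgroup P} [H.Normal]
    {x y c : P} (hx : x ∈ H) (hy : y ∈ H) (hH : ∀ h ∈ H, ∃ i j : ℤ, h = x ^ i * y ^ j)
    (hc : c = ⁅x, y⁆) (hcx : Commute c x) (hcy : Commute c y) (hcp : c ^ p = 1) (g : P) :
    Commute c g := by
  have h : x * y = c * (y * x) := by rw [hc, commutatorElement_def]; group
  have hn : (Subgroup.zpowers c).Normal := by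
    refine ⟨?_⟩
    rintro _ ⟨k, rfl⟩ g
    change g * c ^ k * g⁻¹ ∈ _
    rw [← conj_zpow]
    refine Subgroup.zpow_mem _ ?_ k
    -- A conjugate of `c` is a commutator of two elements of `H`, hence a power of `c`. Thus `⟨c⟩`
    -- is normal of order dividing `p`.
    have h1 : g * c * g⁻¹ = ⁅g * x * g⁻¹, g * y * g⁻¹⁆ := by
      rw [hc]; simp only [commutatorElement_def]; group
    rw [h1]
    exact commutator_mem_zpowers_of_commutes h hcx hcy
      (hH _ (Subgroup.Normal.conj_mem inferInstance _ hx g))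
      (hH _ (Subgroup.Normal.conj_mem inferInstance _ hy g))
  refine hP.commute_of_card_dvd (M := Subgroup.zpowers c) ?_ (Subgroup.mem_zpowers c) g
  rw [Nat.card_zpowers]
  exact orderOf_dvd_of_pow_eq_one hcp

end Nilpotent

/-! ### Bicyclic `p`-groups and their power filtration. -/

section Bicyclic

variable {G : Type*} [Group G]

/-- `H` is the product of the cyclic subgroups of order `p ^ e` generated by its elements `x` and
`y`, which intersect trivially. -/
structure IsBicyclic (p e : ℕ) (H : Subgroup G) (x y : G) : Prop where
  mem_left : x ∈ H
  mem_right : y ∈ H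
  orderOf_left : orderOf x = p ^ e
  orderOf_right : orderOf y = p ^ e
  disjoint : Disjoint (Subgroup.zpowers x) (Subgroup.zpowers y)
  exists_eq : ∀ h ∈ H, ∃ i j : ℤ, h = x ^ i * y ^ j

/-- The subgroup generated by the `p`-th powers of the elements of `H`. -/
def agemo (p : ℕ) (H : Subgroup G) : Subgroup G :=
  Subgroup.closure ((fun h => h ^ p) '' (H : Set G))

theorem pow_mem_agemo {p : ℕ} {H : Subgroup G} {h : G} (hh : h ∈ H) : h ^ p ∈ agemo p H :=
  Subgroup.subset_closure ⟨h, hh, rfl⟩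

theorem agemo_le_iff {p : ℕ} {H K : Subgroup G} : agemo p H ≤ K ↔ ∀ h ∈ H, h ^ p ∈ K := by
  rw [agemo, Subgroup.closure_le]
  constructor
  · intro h a ha
    exact h ⟨a, ha, rfl⟩
  · rintro h _ ⟨a, ha, rfl⟩
    exact h a ha

theorem agemo_le (p : ℕ) (H : Subgroup G) : agemo p H ≤ H :=
  agemo_le_iff.2 fun _ hh => H.pow_mem hh p

instance agemo_normal (p : ℕ) (H : Subgroup G) [hH : H.Normal] : (agemo p H).Normal := by
  refine Subgroup.Normal.mk fun n hn g => ?_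
  have : agemo p H ≤ (agemo p H).comap (MulAut.conj g).toMonoidHom := by
    rw [agemo_le_iff]
    intro h hh
    simp only [Subgroup.mem_comap, MulEquiv.coe_toMonoidHom, MulAut.conj_apply]
    rw [← conj_pow]
    exact pow_mem_agemo (hH.conj_mem _ hh g)
  exact this hn

/-- The iterated subgroups of `p`-th powers. -/
def agemoIter (p : ℕ) (H : Subgroup G) : ℕ → Subgroup G
  | 0 => H
  | i + 1 => agemo p (agemoIter p H i)

instance agemoIter_normal (p : ℕ) (H : Subgroup G) [H.Normal] (i : ℕ) :
    (agemoIter p H i).Normal := by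
  induction i with
  | zero => assumption
  | succ i _ => exact agemo_normal p _

theorem agemoIter_antitone (p : ℕ) (H : Subgroup G) : Antitone (agemoIter p H) :=
  antitone_nat_of_succ_le fun _ => agemo_le p _

theorem pow_mem_agemoIter_succ {p : ℕ} {H : Subgroup G} {i : ℕ} {h : G}
    (hh : h ∈ agemoIter p H i) : h ^ p ∈ agemoIter p H (i + 1) :=
  pow_mem_agemo hh

namespace IsBicyclic

variable {p e : ℕ} {H : Subgroup G} {x y : G}

theorem symm (h : IsBicyclic p e H x y) : IsBicyclic p e H y x where
  mem_left := h.mem_right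
  mem_right := h.mem_left
  orderOf_left := h.orderOf_right
  orderOf_right := h.orderOf_left
  disjoint := h.disjoint.symm
  exists_eq a ha := by
    obtain ⟨i, j, hij⟩ := h.exists_eq a⁻¹ (H.inv_mem ha)
    refine ⟨-j, -i, ?_⟩
    rw [← inv_inv a, hij]
    group

theorem card_eq (h : IsBicyclic p e H x y) : Nat.card H = p ^ (2 * e) := by
  have hinj := Subgroup.mul_injective_of_disjoint h.disjoint
  have : (H : Set G) = Set.range
      (fun g : Subgroup.zpowers x × Subgroup.zpowers y => (g.1 : G) * (g.2 : G)) := by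
    ext a
    constructor
    · intro ha
      obtain ⟨i, j, rfl⟩ := h.exists_eq a ha
      exact ⟨(⟨x ^ i, i, rfl⟩, ⟨y ^ j, j, rfl⟩), rfl⟩
    · rintro ⟨⟨⟨_, i, rfl⟩, ⟨_, j, rfl⟩⟩, rfl⟩
      exact H.mul_mem (H.zpow_mem h.mem_left i) (H.zpow_mem h.mem_right j)
  have h2 : Nat.card H = Nat.card (Subgroup.zpowers x × Subgroup.zpowers y) := by
    rw [← Nat.card_range_of_injective hinj, ← this]; rfl
  rw [h2, Nat.card_prod, Nat.card_zpowers, Nat.card_zpowers, h.orderOf_left, h.orderOf_right]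
  ring

variable [Fact p.Prime]

/-- Some `K` of index `p` in `H` contains `x`; it is normal, so it contains all `p`-th powers. If `p
∤ j`, then `y ∈ K` as well and `K = H`. -/
theorem dvd_right (h : IsBicyclic p (e + 1) H x y) {i j : ℤ}
    (hij : x ^ i * y ^ j ∈ agemo p H) : (p : ℤ) ∣ j := by
  have hp : p.Prime := Fact.out
  have hcard := h.card_eq
  have : Finite H := Nat.finite_of_card_ne_zero (by rw [hcard]; exact pow_ne_zero _ hp.ne_zero)
  let x' : H := ⟨x, h.mem_left⟩
  have hx' : Nat.card (Subgroup.zpowers x') = p ^ (e + 1) := by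
    rw [Nat.card_zpowers, ← h.orderOf_left]
    exact (Subgroup.orderOf_mk _ _)
  obtain ⟨K, hK, hxK⟩ := Sylow.exists_subgroup_card_pow_prime_le p (m := 2 * e + 1)
    (by rw [hcard]; exact pow_dvd_pow _ (by omega)) (Subgroup.zpowers x') hx' (by omega)
  have hidx : K.index = p := by
    have := K.index_mul_card
    rw [hK, hcard, show 2 * (e + 1) = (2 * e + 1) + 1 by ring, pow_succ' p (2 * e + 1)] at this
    exact Nat.eq_of_mul_eq_mul_right (pow_pos hp.pos _) this
  have hn : K.Normal := by
    apply Subgroup.normal_of_index_eq_minFac_card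
    rw [hidx, hcard, hp.pow_minFac (by omega)]
  have hle : agemo p H ≤ K.map H.subtype := by
    rw [agemo_le_iff]
    intro a ha
    refine ⟨(⟨a, ha⟩ : H) ^ p, ?_, rfl⟩
    have := K.pow_index_mem (⟨a, ha⟩ : H)
    rwa [hidx] at this
  have hxK' : x ∈ K.map H.subtype := ⟨x', hxK (Subgroup.mem_zpowers _), rfl⟩
  have hyj : y ^ j ∈ K.map H.subtype :=
    ((K.map H.subtype).mul_mem_cancel_left (zpow_mem hxK' i)).1 (hle hij)
  by_contra hj
  have hyK : y ∈ K.map H.subtype := by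
    have hcop : IsCoprime j ((p ^ (e + 1) : ℕ) : ℤ) := by
      push_cast
      refine IsCoprime.pow_right ?_
      exact ((Nat.prime_iff_prime_int.1 hp).coprime_iff_not_dvd.2 hj).symm
    obtain ⟨a, b, hab⟩ := hcop
    have hy1 : y ^ ((p ^ (e + 1) : ℕ) : ℤ) = 1 := by
      rw [zpow_natCast, ← h.orderOf_right, pow_orderOf_eq_one]
    have : y = (y ^ j) ^ a := by
      calc y = y ^ (a * j + b * ((p ^ (e + 1) : ℕ) : ℤ)) := by rw [hab, zpow_one]
        _ = _ := by rw [zpow_add, mul_comm b, zpow_mul y _ b, hy1, one_zpow, mul_one, mul_comm a,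
                      zpow_mul]
    rw [this]
    exact zpow_mem hyj a
  have htop : H ≤ K.map H.subtype := by
    intro a ha
    obtain ⟨i, j, rfl⟩ := h.exists_eq a ha
    exact mul_mem (zpow_mem hxK' i) (zpow_mem hyK j)
  have hK1 : K = ⊤ := by
    rw [eq_top_iff]
    intro a _
    obtain ⟨b, hb, hba⟩ := htop a.2
    rwa [← Subtype.ext (show (b : G) = a from hba)]
  rw [hK1, Subgroup.index_top] at hidx
  exact hp.one_lt.ne hidx

theorem dvd_left (h : IsBicyclic p (e + 1) H x y) {i j : ℤ}
    (hij : x ^ i * y ^ j ∈ agemo p H) : (p : ℤ) ∣ i := by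
  have h1 : y ^ (-j) * x ^ (-i) ∈ agemo p H := by
    have := (agemo p H).inv_mem hij
    rwa [mul_inv_rev, ← zpow_neg, ← zpow_neg] at this
  exact (Int.dvd_neg).1 (h.symm.dvd_right h1)

/-- By `dvd_left` and `dvd_right` the subgroup generated by `p`-th powers contains no more than the
products `x ^ (p * k) * y ^ (p * l)`, so the factorization descends. -/
theorem agemo_succ (h : IsBicyclic p (e + 1) H x y) :
    IsBicyclic p e (agemo p H) (x ^ p) (y ^ p) where
  mem_left := pow_mem_agemo h.mem_left
  mem_right := pow_mem_agemo h.mem_right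
  orderOf_left := by
    have hp : p.Prime := Fact.out
    rw [orderOf_pow_of_dvd hp.ne_zero (by rw [h.orderOf_left]; exact dvd_pow_self _ (by omega)),
      h.orderOf_left, pow_succ, Nat.mul_div_cancel _ hp.pos]
  orderOf_right := by
    have hp : p.Prime := Fact.out
    rw [orderOf_pow_of_dvd hp.ne_zero (by rw [h.orderOf_right]; exact dvd_pow_self _ (by omega)),
      h.orderOf_right, pow_succ, Nat.mul_div_cancel _ hp.pos]
  disjoint := h.disjoint.mono (by simp) (by simp)
  exists_eq a ha := by
    obtain ⟨i, j, rfl⟩ := h.exists_eq a (agemo_le p H ha)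
    obtain ⟨k, rfl⟩ := h.dvd_left ha
    obtain ⟨l, rfl⟩ := h.dvd_right ha
    exact ⟨k, l, by rw [zpow_mul, zpow_mul, zpow_natCast, zpow_natCast]⟩

theorem iterate {i k : ℕ} (h : IsBicyclic p e H x y) (hik : e = i + k) :
    IsBicyclic p k (agemoIter p H i) (x ^ p ^ i) (y ^ p ^ i) := by
  induction i generalizing k with
  | zero =>
    obtain rfl : e = k := by omega
    simpa [agemoIter] using h
  | succ i ih =>
    have := (ih (k := k + 1) (by omega)).agemo_succ
    rw [← pow_mul, ← pow_mul, ← pow_succ] at this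
    exact this

end IsBicyclic

end Bicyclic

/-! ### Action of `H` and of `g` on the layers of the filtration. -/

/-- Conjugation by `g` acts as `1 + N` with `N` sending `X ↦ Z ↦ W ↦ V ↦ 1`; this is the binomial
expansion of `(1 + N) ^ k`, proved by Pascal's rule. -/
theorem conj_pow_eq_of_unipotent {G : Type*} [Group G] {g X Z W V : G}
    (h1 : g * X * g⁻¹ = X * Z) (h2 : g * Z * g⁻¹ = Z * W) (h3 : g * W * g⁻¹ = W * V)
    (h4 : g * V * g⁻¹ = V) (hZW : Commute Z W) (hWV : Commute W V) (k : ℕ) :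
    g ^ k * X * (g ^ k)⁻¹ = X * Z ^ k * W ^ (k.choose 2) * V ^ (k.choose 3) := by
  induction k with
  | zero => simp
  | succ k ih =>
    calc g ^ (k + 1) * X * (g ^ (k + 1))⁻¹ = g * (g ^ k * X * (g ^ k)⁻¹) * g⁻¹ := by
          rw [pow_succ']; group
      _ = g * X * g⁻¹ * (g * Z * g⁻¹) ^ k * (g * W * g⁻¹) ^ (k.choose 2)
            * (g * V * g⁻¹) ^ (k.choose 3) := by
          rw [ih]; simp only [conj_pow]; group
      _ = X * Z * (Z ^ k * W ^ k) * (W ^ (k.choose 2) * V ^ (k.choose 2)) * V ^ (k.choose 3) := by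
          rw [h1, h2, h3, h4, hZW.mul_pow, hWV.mul_pow]
      _ = X * (Z * Z ^ k) * (W ^ k * W ^ (k.choose 2)) * (V ^ (k.choose 2) * V ^ (k.choose 3)) := by
          group
      _ = _ := by
          rw [← pow_succ', ← pow_add, ← pow_add, Nat.choose_succ_succ' k 1,
            Nat.choose_succ_succ' k 2, Nat.choose_one_right]

namespace IsBicyclic

theorem commute_mk_iff {G : Type*} [Group G] {N : Subgroup G} [N.Normal] {a b : G} :
    Commute (a : G ⧸ N) (b : G ⧸ N) ↔ ⁅a, b⁆ ∈ N := by
  rw [← QuotientGroup.eq_one_iff, commute_iff_eq, commutatorElement_def, QuotientGroup.mk_mul,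
    QuotientGroup.mk_mul, QuotientGroup.mk_mul, QuotientGroup.mk_inv, QuotientGroup.mk_inv,
    ← commutatorElement_def, commutatorElement_eq_one_iff_mul_comm]

variable {P : Type*} [Group P] [Finite P] {p e : ℕ} [hp : Fact p.Prime] {H : Subgroup P}
  [H.Normal] {x g : P}

/-- The layer `H_i / H_{i+1}` is a normal subgroup of order `p ^ 2` in `P / H_{i+1}`, so its
commutators with `P` are central. -/
theorem commute_commutator (hP : IsPGroup p P) {y : P} (hH : IsBicyclic p e H x y) {i : ℕ}
    (hi : i + 1 ≤ e) {n : P} (hn : n ∈ agemoIter p H i) (a b : P) :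
    Commute ((⁅n, a⁆ : P) : P ⧸ agemoIter p H (i + 1)) b := by
  have h1 := (hH.iterate (i := i) (k := e - i) (by omega)).card_eq
  have h2 := (hH.iterate (i := i + 1) (k := e - (i + 1)) (by omega)).card_eq
  have h3 := Subgroup.relIndex_mul_relIndex ⊥ _ _ bot_le (agemoIter_antitone p H (Nat.le_succ i))
  rw [Subgroup.relIndex_bot_left, Subgroup.relIndex_bot_left] at h3
  have h4 := Subgroup.relIndex_ker (QuotientGroup.mk' (agemoIter p H (i + 1)))
    (K := agemoIter p H i)
  rw [QuotientGroup.ker_mk'] at h4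
  have hM : ((agemoIter p H i).map
      (QuotientGroup.mk' (agemoIter p H (i + 1)))).Normal :=
    Subgroup.Normal.map inferInstance _ (QuotientGroup.mk'_surjective _)
  have hcard : Nat.card ((agemoIter p H i).map
      (QuotientGroup.mk' (agemoIter p H (i + 1)))) = p ^ 2 := by
    rw [← h4]
    have h5 : p ^ (2 * (e - (i + 1))) * p ^ 2 = p ^ (2 * (e - i)) := by
      rw [← pow_add]; congr 1; omega
    rw [h1, ← h5, h2] at h3
    exact Nat.eq_of_mul_eq_mul_left (pow_pos hp.out.pos _) h3
  exact (hP.to_quotient _).commute_commutator_of_card_dvd hcard.dvd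
    (Subgroup.mem_map_of_mem _ hn) (a : P ⧸ _) (b : P ⧸ _)

variable (hP : IsPGroup p P) (hH : IsBicyclic p e H x (g * x * g⁻¹))
include hP hH

/-- The generators `X = x ^ p ^ i` and `Y = g X g⁻¹` of `H_i` differ by a commutator, central modulo
`H_{i+1}`. As `x` commutes with `X` it commutes with `Y`, and as `y` commutes with `Y` it commutes
with `X`. -/
theorem commute_mk {i : ℕ} (hi : i + 1 ≤ e) {n h : P} (hn : n ∈ agemoIter p H i)
    (hh : h ∈ H) : Commute (h : P ⧸ agemoIter p H (i + 1)) n := by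
  have hX := (hH.iterate (i := i) (k := e - i) (by omega))
  set y := g * x * g⁻¹ with hy
  set X := x ^ p ^ i with hXdef
  set Y := y ^ p ^ i with hYdef
  have hXY : Y = X * ⁅X⁻¹, g⁆ := by
    rw [hYdef, hy, conj_pow, commutatorElement_def, hXdef]; group
  have hc : ∀ b : P, Commute ((⁅X⁻¹, g⁆ : P) : P ⧸ agemoIter p H (i + 1)) b :=
    hH.commute_commutator hP hi (inv_mem hX.mem_left) g
  have hXY' : (Y : P ⧸ agemoIter p H (i + 1)) = X * (⁅X⁻¹, g⁆ : P) := by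
    rw [hXY]; rfl
  have hYX' : (X : P ⧸ agemoIter p H (i + 1)) = Y * ((⁅X⁻¹, g⁆ : P) : P ⧸ agemoIter p H (i + 1))⁻¹ := by
    rw [hXY', mul_inv_cancel_right]
  have xX : Commute (x : P ⧸ agemoIter p H (i + 1)) X := by
    rw [hXdef, QuotientGroup.mk_pow]; exact Commute.self_pow _ _
  have xY : Commute (x : P ⧸ agemoIter p H (i + 1)) Y := by
    rw [hXY']; exact xX.mul_right (hc x).symm
  have yY : Commute (y : P ⧸ agemoIter p H (i + 1)) Y := by
    rw [hYdef, QuotientGroup.mk_pow]; exact Commute.self_pow _ _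
  have yX : Commute (y : P ⧸ agemoIter p H (i + 1)) X := by
    rw [hYX']; exact yY.mul_right (hc y).symm.inv_right
  obtain ⟨a, b, rfl⟩ := hX.exists_eq n hn
  obtain ⟨c, d, rfl⟩ := hH.exists_eq h hh
  simp only [QuotientGroup.mk_mul, QuotientGroup.mk_zpow]
  exact ((xX.zpow_zpow _ _).mul_right (xY.zpow_zpow _ _)).mul_left
    ((yX.zpow_zpow _ _).mul_right (yY.zpow_zpow _ _))

/-- Modulo `H_{i+2}`, conjugation by `n` multiplies `h` by `⁅n, h⁆ ∈ H_{i+1}`, which commutes with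
`h` and is killed by the `p`-th power. -/
theorem commute_mk_pow {i : ℕ} (hi : i + 2 ≤ e) {n h : P} (hn : n ∈ agemoIter p H i)
    (hh : h ∈ H) : Commute (h ^ p : P ⧸ agemoIter p H (i + 2)) n := by
  have hd : ⁅n, h⁆ ∈ agemoIter p H (i + 1) :=
    commute_mk_iff.1 (hH.commute_mk hP (by omega) hn hh).symm
  have hcomm := hH.commute_mk hP (i := i + 1) hi hd hh
  have hdp : ((⁅n, h⁆ : P) : P ⧸ agemoIter p H (i + 2)) ^ p = 1 := by
    rw [← QuotientGroup.mk_pow, QuotientGroup.eq_one_iff]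
    exact pow_mem_agemoIter_succ hd
  have h1 : (n : P ⧸ agemoIter p H (i + 2)) * h * (n : P ⧸ agemoIter p H (i + 2))⁻¹
      = (⁅n, h⁆ : P) * (h : P ⧸ agemoIter p H (i + 2)) := by
    rw [← QuotientGroup.mk_inv, ← QuotientGroup.mk_mul, ← QuotientGroup.mk_mul,
      ← QuotientGroup.mk_mul, commutatorElement_def]
    congr 1; group
  have h2 : (n : P ⧸ agemoIter p H (i + 2)) * h ^ p * (n : P ⧸ agemoIter p H (i + 2))⁻¹
      = (h : P ⧸ agemoIter p H (i + 2)) ^ p := by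
    rw [← conj_pow, h1, hcomm.symm.mul_pow, hdp, one_mul]
  exact (mul_inv_eq_iff_eq_mul.1 h2).symm

theorem commute_mk_agemoIter_one {i : ℕ} (hi : i + 2 ≤ e) {m n : P}
    (hm : m ∈ agemoIter p H 1) (hn : n ∈ agemoIter p H i) :
    Commute (m : P ⧸ agemoIter p H (i + 2)) n := by
  obtain ⟨a, b, rfl⟩ := (hH.iterate (i := 1) (k := e - 1) (by omega)).exists_eq m hm
  simp only [pow_one, QuotientGroup.mk_mul, QuotientGroup.mk_zpow, QuotientGroup.mk_pow]
  exact ((hH.commute_mk_pow hP hi hn hH.mem_left).zpow_left _).mul_left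
    ((hH.commute_mk_pow hP hi hn hH.mem_right).zpow_left _)

/-- Modulo `H_{i+2}` the subgroup `H_i` has class at most two with commutators killed by `p`. As `p`
is odd, `p ∣ p.choose 2`, so taking `p`-th powers just multiplies both exponents by `p`, and
`dvd_left` and `dvd_right` apply one layer down. -/
theorem mem_succ_of_pow_mem (hp2 : p ≠ 2) {i : ℕ} (hi : i + 2 ≤ e) {n : P}
    (hn : n ∈ agemoIter p H i) (hnp : n ^ p ∈ agemoIter p H (i + 2)) :
    n ∈ agemoIter p H (i + 1) := by
  have hX := (hH.iterate (i := i) (k := e - i) (by omega))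
  have hX1 := (hH.iterate (i := i + 1) (k := e - (i + 2) + 1) (by omega))
  set y := g * x * g⁻¹ with hy
  rw [pow_succ, pow_mul, pow_mul] at hX1
  set X := x ^ p ^ i with hXdef
  set Y := y ^ p ^ i with hYdef
  have hle : agemoIter p H i ≤ H := agemoIter_antitone p H (Nat.zero_le i)
  have hc : ⁅X, Y⁆ ∈ agemoIter p H (i + 1) := commute_mk_iff.1
    (hH.commute_mk hP (by omega) hX.mem_right (hle hX.mem_left))
  have hcX := (hH.commute_mk hP (by omega) hc (hle hX.mem_left)).symm
  have hcY := (hH.commute_mk hP (by omega) hc (hle hX.mem_right)).symm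
  obtain ⟨a, b, rfl⟩ := hX.exists_eq n hn
  have h1 : (X : P ⧸ agemoIter p H (i + 2)) * Y = (⁅X, Y⁆ : P) * ((Y : P ⧸ agemoIter p H (i + 2)) * X) := by
    simp only [← QuotientGroup.mk_mul, commutatorElement_def]
    congr 1; group
  have h2 := mul_pow_of_commutes h1 hcX hcY a b p
  have hcp : ((⁅X, Y⁆ : P) : P ⧸ agemoIter p H (i + 2)) ^ p = 1 := by
    rw [← QuotientGroup.mk_pow, QuotientGroup.eq_one_iff]
    exact pow_mem_agemoIter_succ hc
  obtain ⟨k, hk⟩ := hp.out.dvd_choose_self (k := 2) (by norm_num)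
    (lt_of_le_of_ne hp.out.two_le (Ne.symm hp2))
  have h3 : ((⁅X, Y⁆ : P) : P ⧸ agemoIter p H (i + 2)) ^ (-(a * b * (p.choose 2 : ℤ)))
      = 1 := by
    rw [hk, show -(a * b * ((p * k : ℕ) : ℤ)) = (p : ℤ) * (-(a * b * k)) by push_cast; ring,
      zpow_mul, zpow_natCast, hcp, one_zpow]
  rw [h3, mul_one] at h2
  have h4 : (X ^ p) ^ a * (Y ^ p) ^ b ∈ agemoIter p H (i + 2) := by
    rw [← QuotientGroup.eq_one_iff] at hnp ⊢
    rw [← hnp]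
    simp only [QuotientGroup.mk_mul, QuotientGroup.mk_zpow, QuotientGroup.mk_pow]
    rw [h2, mul_comm a, mul_comm b, zpow_mul, zpow_mul, zpow_natCast, zpow_natCast]
  obtain ⟨k, rfl⟩ := hX1.dvd_left h4
  obtain ⟨l, rfl⟩ := hX1.dvd_right h4
  rw [zpow_mul, zpow_mul, zpow_natCast, zpow_natCast]
  exact mul_mem (zpow_mem hX1.mem_left _) (zpow_mem hX1.mem_right _)

omit hP [Finite P] [H.Normal] in
theorem agemoIter_self : agemoIter p H e = ⊥ := by
  have h := (hH.iterate (i := e) (k := 0) (by omega)).card_eq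
  rwa [mul_zero, pow_zero, Subgroup.card_eq_one] at h

theorem mem_agemoIter_one_of_pow_eq_one (hp2 : p ≠ 2) (he : 1 ≤ e) {h : P} (hh : h ∈ H)
    (hhp : h ^ p ^ (e - 1) = 1) : h ∈ agemoIter p H 1 := by
  by_contra hcon
  -- An element outside `H_1` drops exactly one layer with each `p`-th power, so it has order `p ^
  -- e`.
  have key : ∀ i, i + 1 ≤ e → h ^ p ^ i ∈ agemoIter p H i ∧
      h ^ p ^ i ∉ agemoIter p H (i + 1) := by
    intro i
    induction i with
    | zero => intro _; simpa using ⟨hh, hcon⟩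
    | succ i ih =>
      intro hi
      obtain ⟨h1, h2⟩ := ih (by omega)
      rw [pow_succ, pow_mul]
      exact ⟨pow_mem_agemoIter_succ h1, fun h3 => h2 (hH.mem_succ_of_pow_mem hP hp2 (by omega) h1 h3)⟩
  apply (key (e - 1) (by omega)).2
  rw [hhp]
  exact one_mem _

omit hP [Finite P] [H.Normal] in
-- In the bicyclic factorization of `H_i` the second exponent of this element is `1`, which `p` does
-- not divide.
theorem conj_mul_inv_notMem {i : ℕ} (hi : i + 1 ≤ e)
    (h : ((x ^ p ^ i)⁻¹ * (g * x ^ p ^ i * g⁻¹)) ∈ agemoIter p H (i + 1)) : False := by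
  have hX := (hH.iterate (i := i) (k := e - (i + 1) + 1) (by omega))
  rw [conj_pow] at hX
  have : (x ^ p ^ i) ^ (-1 : ℤ) * (g * x ^ p ^ i * g⁻¹) ^ (1 : ℤ) ∈ agemoIter p H (i + 1) := by
    rwa [zpow_one, zpow_neg_one]
  have := hX.dvd_right this
  exact hp.out.one_lt.ne' (by exact_mod_cast Int.eq_one_of_dvd_one (by positivity) this)

/-- Since `g ^ p ∈ H_1` fixes `X` modulo `H_{i+2}`, the binomial expansion gives `Z ^ p * V ^
(p.choose 3) = 1` there. But `Z ∉ H_{i+1}` makes `Z ^ p` nontrivial, so `p ∤ p.choose 3` and `V` is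
nontrivial. -/
theorem eq_three_and_notMem (hp2 : p ≠ 2) (hg : g ^ p ∈ agemoIter p H 1) {i : ℕ}
    (hi : i + 2 ≤ e) {X Z W V : P} (hX : X = x ^ p ^ i) (hZ : Z = X⁻¹ * (g * X * g⁻¹))
    (hW : W = Z⁻¹ * (g * Z * g⁻¹)) (hV : V = W⁻¹ * (g * W * g⁻¹)) :
    (Z ∈ agemoIter p H i ∧ Z ∉ agemoIter p H (i + 1)) ∧
    W ∈ agemoIter p H (i + 1) ∧
    p = 3 ∧ V ∉ agemoIter p H (i + 2) := by
  have hle : agemoIter p H i ≤ H := agemoIter_antitone p H (Nat.zero_le i)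
  have hXi : X ∈ agemoIter p H i := by
    rw [hX]; exact (hH.iterate (i := i) (k := e - i) (by omega)).mem_left
  have hZi : Z ∈ agemoIter p H i := by
    rw [hZ]
    exact mul_mem (inv_mem hXi) (Subgroup.Normal.conj_mem inferInstance _ hXi g)
  have hZi1 : Z ∉ agemoIter p H (i + 1) := by
    rw [hZ, hX]; exact hH.conj_mul_inv_notMem (by omega)
  have hZ' : Z = ⁅X⁻¹, g⁆ := by rw [hZ, commutatorElement_def]; group
  have hW' : W = ⁅Z⁻¹, g⁆ := by rw [hW, commutatorElement_def]; group
  have hV' : V = ⁅W⁻¹, g⁆ := by rw [hV, commutatorElement_def]; group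
  have hWi : W ∈ agemoIter p H (i + 1) := by
    rw [hW']
    apply commute_mk_iff.1
    rw [QuotientGroup.mk_inv, hZ']
    exact (hH.commute_commutator hP (by omega) (inv_mem hXi) g g).inv_left
  have hVi : V ∈ agemoIter p H (i + 1) := by
    rw [hV]
    exact mul_mem (inv_mem hWi) (Subgroup.Normal.conj_mem inferInstance _ hWi g)
  have hVc : Commute (V : P ⧸ agemoIter p H (i + 2)) g := by
    rw [hV']; exact hH.commute_commutator hP (by omega) (inv_mem hWi) g g
  refine ⟨⟨hZi, hZi1⟩, hWi, ?_⟩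
  have hZW : Commute (Z : P ⧸ agemoIter p H (i + 2)) W :=
    hH.commute_mk hP (by omega) hWi (hle hZi)
  have hWV : Commute (W : P ⧸ agemoIter p H (i + 2)) V :=
    hH.commute_mk hP (by omega) hVi (agemoIter_antitone p H (Nat.zero_le (i + 1)) hWi)
  have h1 : (g : P ⧸ agemoIter p H (i + 2)) * X * (g : P ⧸ agemoIter p H (i + 2))⁻¹ = X * (Z : P ⧸ agemoIter p H (i + 2)) := by
    simp only [← QuotientGroup.mk_mul, ← QuotientGroup.mk_inv, hZ]; congr 1; group
  have h2 : (g : P ⧸ agemoIter p H (i + 2)) * Z * (g : P ⧸ agemoIter p H (i + 2))⁻¹ = Z * (W : P ⧸ agemoIter p H (i + 2)) := by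
    simp only [← QuotientGroup.mk_mul, ← QuotientGroup.mk_inv, hW]; congr 1; group
  have h3 : (g : P ⧸ agemoIter p H (i + 2)) * W * (g : P ⧸ agemoIter p H (i + 2))⁻¹ = W * (V : P ⧸ agemoIter p H (i + 2)) := by
    simp only [← QuotientGroup.mk_mul, ← QuotientGroup.mk_inv, hV]; congr 1; group
  have h4 : (g : P ⧸ agemoIter p H (i + 2)) * V * (g : P ⧸ agemoIter p H (i + 2))⁻¹ = V := by
    rw [hVc.symm.eq]; group
  have h5 := conj_pow_eq_of_unipotent h1 h2 h3 h4 hZW hWV p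
  have h6 : (g : P ⧸ agemoIter p H (i + 2)) ^ p * X * ((g : P ⧸ agemoIter p H (i + 2)) ^ p)⁻¹ = X := by
    have := hH.commute_mk_agemoIter_one hP hi hg hXi
    rw [QuotientGroup.mk_pow] at this
    rw [this.eq]; group
  have hpow : ∀ {n : P}, n ∈ agemoIter p H (i + 1) → ∀ {k : ℕ}, p ∣ k →
      (n : P ⧸ agemoIter p H (i + 2)) ^ k = 1 := by
    rintro n hn _ ⟨k, rfl⟩
    rw [pow_mul, ← QuotientGroup.mk_pow, (QuotientGroup.eq_one_iff _).2
      (pow_mem_agemoIter_succ hn), one_pow]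
  have hp3 : 3 ≤ p := lt_of_le_of_ne hp.out.two_le (Ne.symm hp2)
  rw [h6, hpow hWi (hp.out.dvd_choose_self (by norm_num) hp3), mul_one, mul_assoc] at h5
  have h7 := left_eq_mul.1 h5
  have hZp : (Z : P ⧸ agemoIter p H (i + 2)) ^ p ≠ 1 := by
    rw [← QuotientGroup.mk_pow, Ne, QuotientGroup.eq_one_iff]
    exact fun h => hZi1 (hH.mem_succ_of_pow_mem hP hp2 hi hZi h)
  constructor
  · by_contra h
    rw [hpow hVi (hp.out.dvd_choose_self (by norm_num) (lt_of_le_of_ne hp3 (Ne.symm h))),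
      mul_one] at h7
    exact hZp h7
  · intro h
    rw [(QuotientGroup.eq_one_iff V).2 h, one_pow, mul_one] at h7
    exact hZp h7

end IsBicyclic

/-! ### Descent of the commutator of `x` and `y` down the filtration. -/

theorem QuotientGroup.mk_commutatorElement {G : Type*} [Group G] {N : Subgroup G} [N.Normal]
    (a b : G) : ((⁅a, b⁆ : G) : G ⧸ N) = ⁅(a : G ⧸ N), (b : G ⧸ N)⁆ := rfl

namespace IsBicyclic

theorem commute_of_commute {G : Type*} [Group G] {p e : ℕ} {H N : Subgroup G} [N.Normal] {x y : G}
    (hH : IsBicyclic p e H x y) (hxy : Commute (x : G ⧸ N) y) {a b : G} (ha : a ∈ H) (hb : b ∈ H) :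
    Commute (a : G ⧸ N) b := by
  obtain ⟨i, j, rfl⟩ := hH.exists_eq a ha
  obtain ⟨k, l, rfl⟩ := hH.exists_eq b hb
  simp only [QuotientGroup.mk_mul, QuotientGroup.mk_zpow]
  exact (((Commute.refl _).zpow_zpow _ _).mul_right (hxy.zpow_zpow _ _)).mul_left
    ((hxy.symm.zpow_zpow _ _).mul_right ((Commute.refl _).zpow_zpow _ _))

/-- The computation excluding an invariant cyclic subgroup of order `p ^ 2` in an abelian group of
type `(p ^ 2, p ^ 2)` on which `g` acts with a Jordan block of length three. -/
theorem eq_one_of_conj_eq_mul_zpow {G : Type*} [Group G] {g X Z W V c : G} {p : ℕ} [hp : Fact p.Prime]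
    (hXZ : Commute X Z) (hZW : Commute Z W) (hWV : Commute W V)
    (h1 : g * X * g⁻¹ = X * Z) (h2 : g * Z * g⁻¹ = Z * W) (h3 : g * W * g⁻¹ = W * V)
    (hX : (X ^ p) ^ p = 1) (hW : W ^ p = 1) (hV : V ^ p = 1) {a b k : ℤ}
    (hc : c = X ^ a * Z ^ b) (hgc : g * c * g⁻¹ = c * (c ^ p) ^ k)
    (ha : (c ^ p) ^ k = Z ^ a * W ^ b → (p : ℤ) ∣ a) (hb : ¬ (p : ℤ) ∣ b) : V = 1 := by
  have zz : ∀ m n : ℤ, Commute (Z ^ m) (W ^ n) := fun m n => hZW.zpow_zpow m n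
  have h4 : g * c * g⁻¹ = c * (Z ^ a * W ^ b) := by
    calc g * c * g⁻¹ = (g * X * g⁻¹) ^ a * (g * Z * g⁻¹) ^ b := by
          rw [hc, conj_zpow, conj_zpow]; group
      _ = X ^ a * (Z ^ a * Z ^ b) * W ^ b := by
          rw [h1, h2, hXZ.mul_zpow, hZW.mul_zpow]; group
      _ = X ^ a * (Z ^ b * Z ^ a) * W ^ b := by rw [← zpow_add, ← zpow_add, add_comm]
      _ = _ := by rw [hc]; group
  have h5 : (c ^ p) ^ k = Z ^ a * W ^ b := by
    rw [hgc] at h4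
    exact mul_left_cancel h4
  obtain ⟨m, rfl⟩ := ha h5
  -- Once `p ∣ a`, the `X` part of `c ^ p` is a power of `X ^ (p * p) = 1`.
  have h6 : c ^ p = Z ^ (b * p) := by
    rw [hc, (hXZ.zpow_zpow _ _).mul_pow, ← zpow_natCast, ← zpow_natCast, ← zpow_mul, ← zpow_mul,
      show (p : ℤ) * m * p = (p : ℤ) * p * m by ring, zpow_mul, zpow_mul, zpow_natCast,
      zpow_natCast, hX, one_zpow, one_mul]
  have h7 : Z ^ ((p : ℤ) * (b * k - m)) = W ^ b := by
    rw [h6, ← zpow_mul] at h5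
    rw [show (p : ℤ) * (b * k - m) = -(p * m) + b * p * k by ring, zpow_add, h5]
    group
  -- Conjugating by `g` leaves the `p`-multiple power of `Z` unchanged, because `W ^ p = 1`, but
  -- multiplies `W ^ b` by `V ^ b`. Hence `V ^ b = 1`.
  have h8 : (g * Z * g⁻¹) ^ ((p : ℤ) * (b * k - m)) = (g * W * g⁻¹) ^ b := by
    rw [conj_zpow, conj_zpow, h7]
  rw [h2, h3, hZW.mul_zpow, hWV.mul_zpow, h7, zpow_mul W, zpow_natCast, hW, one_zpow] at h8
  have h9 : V ^ b = 1 := (mul_left_cancel h8).symm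
  obtain ⟨u, v, huv⟩ := ((Nat.prime_iff_prime_int.1 hp.out).coprime_iff_not_dvd.2 hb)
  calc V = V ^ (u * p + v * b) := by rw [huv, zpow_one]
    _ = 1 := by
      rw [zpow_add, mul_comm u, mul_comm v, zpow_mul, zpow_mul, h9, zpow_natCast, hV, one_zpow,
        one_zpow, one_mul]

variable {P : Type*} [Group P] [Finite P] {p e : ℕ} [hp : Fact p.Prime] {H : Subgroup P}
  [H.Normal] {x g : P}

theorem commute_mk_commutator (hP : IsPGroup p P) {y : P} (hH : IsBicyclic p e H x y)
    {N : Subgroup P} [N.Normal] {c : P} (hc : c = ⁅x, y⁆) (hcx : Commute (c : P ⧸ N) x)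
    (hcy : Commute (c : P ⧸ N) y) (hcp : c ^ p ∈ N) (t : P) : Commute (c : P ⧸ N) t := by
  have : (H.map (QuotientGroup.mk' N)).Normal :=
    Subgroup.Normal.map inferInstance _ (QuotientGroup.mk'_surjective _)
  refine (hP.to_quotient N).commute_of_normal_of_pow_eq_one (H := H.map (QuotientGroup.mk' N))
    (Subgroup.mem_map_of_mem _ hH.mem_left) (Subgroup.mem_map_of_mem _ hH.mem_right) ?_ ?_
    hcx hcy ?_ _
  · rintro _ ⟨h, hh, rfl⟩
    obtain ⟨i, j, rfl⟩ := hH.exists_eq h hh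
    exact ⟨i, j, by simp⟩
  · rw [hc]; rfl
  · rw [← QuotientGroup.mk_pow]
    exact (QuotientGroup.eq_one_iff _).2 hcp

variable (hP : IsPGroup p P) (hH : IsBicyclic p e H x (g * x * g⁻¹))
include hP hH

/-- Conjugation by `v` turns `u ^ p ^ f` into `(c * u) ^ p ^ f` with `c = ⁅v, u⁆`. The class-two
correction has exponent `(p ^ f).choose 2`, a multiple of `p` for odd `p`, so it vanishes modulo
`H_{f+2}`. -/
theorem mk_commutator_pow (hp2 : p ≠ 2) {f : ℕ} (hf : 1 ≤ f) (hfe : f + 2 ≤ e) {u v : P}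
    (hu : u ∈ H) (huv : ⁅v, u⁆ ∈ agemoIter p H f) :
    ((⁅v, u ^ p ^ f⁆ : P) : P ⧸ agemoIter p H (f + 2))
      = ((⁅v, u⁆ : P) : P ⧸ agemoIter p H (f + 2)) ^ p ^ f := by
  have hle : agemoIter p H f ≤ H := agemoIter_antitone p H (Nat.zero_le f)
  set c := ⁅v, u⁆ with hc
  have hd : ⁅c, u⁆ ∈ agemoIter p H (f + 1) :=
    commute_mk_iff.1 (hH.commute_mk hP (by omega) huv hu).symm
  have h1 : (c : P ⧸ agemoIter p H (f + 2)) * u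
      = (⁅c, u⁆ : P) * ((u : P ⧸ agemoIter p H (f + 2)) * c) := by
    simp only [← QuotientGroup.mk_mul]
    congr 1
    rw [commutatorElement_def c u]; group
  have h2 := mul_pow_of_commutes h1 (hH.commute_mk hP (by omega) hd (hle huv)).symm
    (hH.commute_mk hP (by omega) hd hu).symm 1 1 (p ^ f)
  have hdp : ((⁅c, u⁆ : P) : P ⧸ agemoIter p H (f + 2)) ^ p = 1 := by
    rw [← QuotientGroup.mk_pow, QuotientGroup.eq_one_iff]
    exact pow_mem_agemoIter_succ hd
  have h2p : 2 ≠ p ^ f := fun h => hp2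
    ((Nat.prime_dvd_prime_iff_eq hp.out Nat.prime_two).1 (h ▸ dvd_pow_self p (by omega)))
  obtain ⟨k, hk⟩ := hp.out.dvd_choose_pow (n := f) (k := 2) (by norm_num) h2p
  have h0 : ((⁅c, u⁆ : P) : P ⧸ agemoIter p H (f + 2)) ^ (-(1 * 1 * (((p ^ f).choose 2 : ℕ) : ℤ)))
      = 1 := by
    rw [hk, show -(1 * 1 * ((p * k : ℕ) : ℤ)) = (p : ℤ) * (-(k : ℤ)) by push_cast; ring, zpow_mul,
      zpow_natCast, hdp, one_zpow]
  rw [h0, mul_one, one_mul, zpow_one, zpow_one, zpow_natCast, zpow_natCast] at h2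
  have h3 : (v : P ⧸ agemoIter p H (f + 2)) * u * (v : P ⧸ agemoIter p H (f + 2))⁻¹ = c * u := by
    simp only [← QuotientGroup.mk_mul, ← QuotientGroup.mk_inv]
    congr 1
    rw [hc, commutatorElement_def]; group
  rw [QuotientGroup.mk_commutatorElement, commutatorElement_def, QuotientGroup.mk_pow, ← conj_pow,
    h3, h2]
  group

/-- Modulo `c ^ p` and `H_{f+2}`, the element `c` commutes with `x` and `y` and has order dividing
`p`, so it is central in the quotient of `P`. Hence `g` changes it only by a power of `c ^ p`. -/
theorem mk_conj_commutator (hp2 : p ≠ 2) {f : ℕ} (hf : 1 ≤ f) (hfe : f + 2 ≤ e) {c : P}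
    (hc : c = ⁅x, g * x * g⁻¹⁆) (hcf : c ∈ agemoIter p H f) :
    ∃ k : ℤ, (g : P ⧸ agemoIter p H (f + 2)) * c * (g : P ⧸ agemoIter p H (f + 2))⁻¹
      = c * ((c : P ⧸ agemoIter p H (f + 2)) ^ p) ^ k := by
  have hle : agemoIter p H f ≤ H := agemoIter_antitone p H (Nat.zero_le f)
  set y := g * x * g⁻¹ with hy
  set Q := P ⧸ agemoIter p H (f + 2)
  have hc1 : ∀ t : P, Commute (c : P ⧸ agemoIter p H (f + 1)) t := by
    exact hH.commute_mk_commutator hP hc (hH.commute_mk hP (by omega) hcf hH.mem_left).symm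
      (hH.commute_mk hP (by omega) hcf hH.mem_right).symm (pow_mem_agemoIter_succ hcf)
  -- `c` is central modulo `H_{f+1}`, so a conjugation alters it by an element of `H_{f+1}`, and the
  -- `p`-th power removes the change. Thus `⟨c ^ p⟩` is normal and may be factored out.
  have hcp : ∀ t : P, (t : Q) * (c : Q) ^ p * (t : Q)⁻¹ = (c : Q) ^ p := by
    intro t
    have hn : ⁅c⁻¹, t⁆ ∈ agemoIter p H (f + 1) := by
      apply commute_mk_iff.1
      rw [QuotientGroup.mk_inv]
      exact (hc1 t).inv_left
    have h1 : (t : Q) * c * (t : Q)⁻¹ = c * (⁅c⁻¹, t⁆ : P) := by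
      simp only [← QuotientGroup.mk_mul, ← QuotientGroup.mk_inv]
      congr 1
      rw [commutatorElement_def]; group
    have h2 : Commute (c : Q) (⁅c⁻¹, t⁆ : P) := hH.commute_mk hP (by omega) hn (hle hcf)
    have h3 : ((⁅c⁻¹, t⁆ : P) : Q) ^ p = 1 := by
      rw [← QuotientGroup.mk_pow, QuotientGroup.eq_one_iff]
      exact pow_mem_agemoIter_succ hn
    rw [← conj_pow, h1, h2.mul_pow, h3, mul_one]
  have hZn : (Subgroup.zpowers ((c : Q) ^ p)).Normal := by
    refine ⟨?_⟩
    rintro _ ⟨k, rfl⟩ q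
    obtain ⟨t, rfl⟩ := QuotientGroup.mk_surjective q
    refine ⟨k, ?_⟩
    change _ = _ * ((c : Q) ^ p) ^ k * _
    rw [← conj_zpow, hcp]
  let D : Subgroup P := (Subgroup.zpowers ((c : Q) ^ p)).comap
    (QuotientGroup.mk' (agemoIter p H (f + 2)))
  have hD : ∀ t : P, t ∈ D ↔ (t : Q) ∈ Subgroup.zpowers ((c : Q) ^ p) := fun t => Iff.rfl
  obtain ⟨r, hr⟩ : p ∣ p ^ f := dvd_pow_self p (by omega)
  have hyx : ⁅y, x⁆ = c⁻¹ := by rw [hc, commutatorElement_inv]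
  -- This commutator is `c⁻¹ ^ p ^ f`, and `f ≥ 1` makes it a power of `c ^ p`.
  have hXy : Commute (y : P ⧸ D) (x ^ p ^ f : P) := by
    rw [commute_mk_iff, hD, hH.mk_commutator_pow hP hp2 hf hfe hH.mem_left
      (by rw [hyx]; exact inv_mem hcf), hyx, QuotientGroup.mk_inv, hr, pow_mul, inv_pow]
    exact pow_mem (inv_mem (Subgroup.mem_zpowers _)) _
  have hYx : Commute (x : P ⧸ D) (y ^ p ^ f : P) := by
    rw [commute_mk_iff, hD, hH.mk_commutator_pow hP hp2 hf hfe hH.mem_right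
      (by rw [← hc]; exact hcf), ← hc, hr, pow_mul]
    exact pow_mem (Subgroup.mem_zpowers _) _
  have hXx : Commute (x : P ⧸ D) (x ^ p ^ f : P) := by
    rw [QuotientGroup.mk_pow]; exact Commute.self_pow _ _
  have hYy : Commute (y : P ⧸ D) (y ^ p ^ f : P) := by
    rw [QuotientGroup.mk_pow]; exact Commute.self_pow _ _
  obtain ⟨a, b, hab⟩ := (hH.iterate (i := f) (k := e - f) (by omega)).exists_eq c hcf
  have hcab : (c : P ⧸ D) = ((x ^ p ^ f : P) : P ⧸ D) ^ a * ((y ^ p ^ f : P) : P ⧸ D) ^ b := by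
    rw [← QuotientGroup.mk_zpow, ← QuotientGroup.mk_zpow, ← QuotientGroup.mk_mul]
    exact congrArg _ hab
  have hcg : Commute (c : P ⧸ D) g := by
    refine hH.commute_mk_commutator hP hc ?_ ?_ ?_ g
    · rw [hcab]; exact ((hXx.zpow_right a).mul_right (hYx.zpow_right b)).symm
    · rw [hcab]; exact ((hXy.zpow_right a).mul_right (hYy.zpow_right b)).symm
    · rw [hD, QuotientGroup.mk_pow]; exact Subgroup.mem_zpowers _
  have hcg' : ⁅c⁻¹, g⁆ ∈ D := by
    apply commute_mk_iff.1
    rw [QuotientGroup.mk_inv]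
    exact hcg.inv_left
  obtain ⟨k, hk⟩ := (hD _).1 hcg'
  refine ⟨k, ?_⟩
  change ((c : Q) ^ p) ^ k = _ at hk
  rw [hk, QuotientGroup.mk_commutatorElement, commutatorElement_def, QuotientGroup.mk_inv]
  group

/-- Otherwise `c ∉ H_{f+1}` spans a `g`-invariant cyclic subgroup of `H_f` modulo `H_{f+2}`, where
`H_f` is abelian because `f ≥ 1`. `eq_one_of_conj_eq_mul_zpow` then gives `V = 1`, against
`eq_three_and_notMem`. -/
theorem commutator_mem_agemoIter_succ (hp2 : p ≠ 2) (hg : g ^ p ∈ agemoIter p H 1) {f : ℕ}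
    (hf : 1 ≤ f) (hfe : f + 2 ≤ e) (hcf : ⁅x, g * x * g⁻¹⁆ ∈ agemoIter p H f) :
    ⁅x, g * x * g⁻¹⁆ ∈ agemoIter p H (f + 1) := by
  by_contra hcon
  obtain ⟨c, hc⟩ : ∃ c, c = ⁅x, g * x * g⁻¹⁆ := ⟨_, rfl⟩
  rw [← hc] at hcf hcon
  obtain ⟨X, hX⟩ : ∃ X, X = x ^ p ^ f := ⟨_, rfl⟩
  obtain ⟨Z, hZ⟩ : ∃ Z, Z = X⁻¹ * (g * X * g⁻¹) := ⟨_, rfl⟩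
  obtain ⟨W, hW⟩ : ∃ W, W = Z⁻¹ * (g * Z * g⁻¹) := ⟨_, rfl⟩
  obtain ⟨V, hV⟩ : ∃ V, V = W⁻¹ * (g * W * g⁻¹) := ⟨_, rfl⟩
  obtain ⟨⟨hZf, -⟩, hWf, -, hVn⟩ := hH.eq_three_and_notMem hP hp2 hg hfe hX hZ hW hV
  have hB := hH.iterate (i := f) (k := e - (f + 1) + 1) (by omega)
  have hXf : X ∈ agemoIter p H f := hX ▸ hB.mem_left
  have hVf : V ∈ agemoIter p H (f + 1) := by
    rw [hV]
    exact mul_mem (inv_mem hWf) (Subgroup.Normal.conj_mem inferInstance _ hWf g)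
  have hW0 : W ∈ agemoIter p H f := agemoIter_antitone p H (Nat.le_succ f) hWf
  have hV0 : V ∈ agemoIter p H f := agemoIter_antitone p H (Nat.le_succ f) hVf
  have comm : ∀ {m n : P}, m ∈ agemoIter p H f → n ∈ agemoIter p H f →
      Commute (m : P ⧸ agemoIter p H (f + 2)) n := fun hm hn =>
    hH.commute_mk_agemoIter_one hP hfe (agemoIter_antitone p H hf hm) hn
  have hYX : (g * x * g⁻¹) ^ p ^ f = X * Z := by
    rw [hZ, hX, conj_pow]; group
  rw [hYX, ← hX] at hB
  obtain ⟨a, b, hab⟩ := hB.exists_eq c hcf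
  have hpow : ∀ {n : P}, n ∈ agemoIter p H (f + 1) →
      (n : P ⧸ agemoIter p H (f + 2)) ^ p = 1 := by
    intro n hn
    rw [← QuotientGroup.mk_pow, (QuotientGroup.eq_one_iff _).2 (pow_mem_agemoIter_succ hn)]
  obtain ⟨k, hk⟩ := hH.mk_conj_commutator hP hp2 hf hfe hc hcf
  -- Since `g X g⁻¹ = X * Z`, passing to the basis `X`, `Z` changes the exponents `(a, b)` to `(a +
  -- b, b)`.
  have hc' : (c : P ⧸ agemoIter p H (f + 2)) = X ^ (a + b) * (Z : P ⧸ agemoIter p H (f + 2)) ^ b := by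
    rw [hab, QuotientGroup.mk_mul, QuotientGroup.mk_zpow, QuotientGroup.mk_zpow,
      QuotientGroup.mk_mul, (comm hXf hZf).mul_zpow, ← mul_assoc, ← zpow_add]
  -- Both `c ^ p` and `W` lie in `H_{f+1}`, so `Z ^ (a + b)` does too, and `dvd_right` reads off the
  -- divisibility.
  have ha : ((c : P ⧸ agemoIter p H (f + 2)) ^ p) ^ k
      = Z ^ (a + b) * (W : P ⧸ agemoIter p H (f + 2)) ^ b → (p : ℤ) ∣ a + b := by
    intro h
    refine hB.dvd_right (i := -(a + b)) ?_
    have h1 : X ^ (-(a + b)) * (X * Z) ^ (a + b) * ((c ^ p) ^ k * (W ^ b)⁻¹)⁻¹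
        ∈ agemoIter p H (f + 2) := by
      rw [← QuotientGroup.eq_one_iff]
      simp only [QuotientGroup.mk_mul, QuotientGroup.mk_zpow, QuotientGroup.mk_pow,
        QuotientGroup.mk_inv]
      rw [h, (comm hXf hZf).mul_zpow]
      group
    exact ((agemoIter p H (f + 1)).mul_mem_cancel_right (inv_mem (mul_mem
      (zpow_mem (pow_mem_agemoIter_succ hcf) _) (inv_mem (zpow_mem hWf _))))).1
      (agemoIter_antitone p H (Nat.le_succ (f + 1)) h1)
  have h1 : (g : P ⧸ agemoIter p H (f + 2)) * X * (g : P ⧸ agemoIter p H (f + 2))⁻¹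
      = X * (Z : P ⧸ agemoIter p H (f + 2)) := by
    simp only [← QuotientGroup.mk_mul, ← QuotientGroup.mk_inv, hZ]; congr 1; group
  have h2 : (g : P ⧸ agemoIter p H (f + 2)) * Z * (g : P ⧸ agemoIter p H (f + 2))⁻¹
      = Z * (W : P ⧸ agemoIter p H (f + 2)) := by
    simp only [← QuotientGroup.mk_mul, ← QuotientGroup.mk_inv, hW]; congr 1; group
  have h3 : (g : P ⧸ agemoIter p H (f + 2)) * W * (g : P ⧸ agemoIter p H (f + 2))⁻¹
      = W * (V : P ⧸ agemoIter p H (f + 2)) := by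
    simp only [← QuotientGroup.mk_mul, ← QuotientGroup.mk_inv, hV]; congr 1; group
  refine hVn ((QuotientGroup.eq_one_iff V).1 (eq_one_of_conj_eq_mul_zpow (p := p)
    (comm hXf hZf) (comm hZf hW0) (comm hW0 hV0) h1 h2 h3 ?_ (hpow hWf) (hpow hVf)
    hc' hk ha ?_))
  · rw [← QuotientGroup.mk_pow]
    exact hpow (pow_mem_agemoIter_succ hXf)
  -- If `p ∣ b`, then also `p ∣ a`, and `c` would be a product of `p`-th powers from `H_f`, hence in
  -- `H_{f+1}`.
  · intro hb
    have hab' : (p : ℤ) ∣ a + b := by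
      apply ha
      have h4 : (g : P ⧸ agemoIter p H (f + 2)) * c * (g : P ⧸ agemoIter p H (f + 2))⁻¹
          = c * (Z ^ (a + b) * (W : P ⧸ agemoIter p H (f + 2)) ^ b) := by
        rw [hc']
        calc _ = (g * X * (g : P ⧸ agemoIter p H (f + 2))⁻¹) ^ (a + b)
              * (g * Z * (g : P ⧸ agemoIter p H (f + 2))⁻¹) ^ b := by
              rw [conj_zpow, conj_zpow]; group
          _ = (X : P ⧸ agemoIter p H (f + 2)) ^ (a + b)
              * (Z ^ (a + b) * (Z : P ⧸ agemoIter p H (f + 2)) ^ b)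
              * (W : P ⧸ agemoIter p H (f + 2)) ^ b := by
              rw [h1, h2, (comm hXf hZf).mul_zpow, (comm hZf hW0).mul_zpow]; group
          _ = _ := by rw [← zpow_add, add_comm (a + b) b, zpow_add]; group
      rw [hk] at h4
      exact mul_left_cancel h4
    obtain ⟨b', rfl⟩ := hb
    obtain ⟨a', rfl⟩ := (Int.dvd_add_left (dvd_mul_right _ _)).1 hab'
    apply hcon
    rw [hab, zpow_mul, zpow_mul, zpow_natCast, zpow_natCast]
    exact mul_mem (zpow_mem (pow_mem_agemoIter_succ hXf) _)
      (zpow_mem (pow_mem_agemoIter_succ (mul_mem hXf hZf)) _)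

theorem commutator_mem_agemoIter (hp2 : p ≠ 2) (hg : g ^ p ∈ agemoIter p H 1) (he : 2 ≤ e) :
    ⁅x, g * x * g⁻¹⁆ ∈ agemoIter p H (e - 1) := by
  have key : ∀ f, 1 ≤ f → f + 1 ≤ e → ⁅x, g * x * g⁻¹⁆ ∈ agemoIter p H f := by
    intro f hf
    induction f, hf using Nat.le_induction with
    | base =>
      intro _
      exact commute_mk_iff.1 (hH.commute_mk hP (i := 0) (by omega) hH.mem_right hH.mem_left)
    | succ f hf ih =>
      intro hfe
      exact hH.commutator_mem_agemoIter_succ hP hp2 hg hf (by omega) (ih (by omega))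
  exact key _ (by omega) (by omega)

end IsBicyclic

/-! ### The presented metacyclic groups: normal form, invariants, recognition. -/

namespace MetacyclicGroup

variable (p e f : ℕ)

/-- The generator `x` of `MetacyclicGroup p e f`. -/
def genX : MetacyclicGroup p e f := PresentedGroup.of 0

/-- The generator `z` of `MetacyclicGroup p e f`. -/
def genZ : MetacyclicGroup p e f := PresentedGroup.of 1

theorem genX_pow : genX p e f ^ p ^ e = 1 :=
  PresentedGroup.one_of_mem (rels := metacyclicRels p e f) (x := FreeGroup.of 0 ^ p ^ e)
    (by simp [metacyclicRels])

theorem genZ_pow : genZ p e f ^ p ^ e = 1 :=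
  PresentedGroup.one_of_mem (rels := metacyclicRels p e f) (x := FreeGroup.of 1 ^ p ^ e)
    (by simp [metacyclicRels])

theorem genX_inv_mul_genZ_mul_genX :
    (genX p e f)⁻¹ * genZ p e f * genX p e f = genZ p e f ^ (1 + p ^ f) :=
  mul_inv_eq_one.1 (PresentedGroup.one_of_mem (rels := metacyclicRels p e f)
    (x := (FreeGroup.of 0)⁻¹ * FreeGroup.of 1 * FreeGroup.of 0 * (FreeGroup.of 1 ^ (1 + p ^ f))⁻¹)
    (by simp [metacyclicRels]))

variable {p e f}

/-- The homomorphism given by two elements satisfying the defining relations. -/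
theorem exists_hom {G : Type*} [Group G] {s z : G} (hs : s ^ p ^ e = 1) (hz : z ^ p ^ e = 1)
    (hsz : s⁻¹ * z * s = z ^ (1 + p ^ f)) :
    ∃ φ : MetacyclicGroup p e f →* G, φ (genX p e f) = s ∧ φ (genZ p e f) = z := by
  have h : ∀ r ∈ metacyclicRels p e f, FreeGroup.lift ![s, z] r = 1 := by
    rintro r (rfl | rfl | rfl)
    · simpa using hs
    · simpa using hz
    · simp [hsz]
  refine ⟨PresentedGroup.toGroup h, ?_, ?_⟩
  · simp [genX]
  · simp [genZ]

theorem exists_eq [hp : Fact p.Prime] (a : MetacyclicGroup p e f) :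
    ∃ i j : ℤ, a = genX p e f ^ i * genZ p e f ^ j := by
  set α := genX p e f with hα
  set β := genZ p e f with hβ
  have hpos : 0 < p ^ e := pow_pos hp.out.pos e
  -- The relation shows only that `m ↦ α⁻¹ * m * α` maps `⟨β⟩` into itself, so `α⁻¹` is rewritten as
  -- a nonnegative power to stay on that side.
  have hαinv : α⁻¹ = α ^ (p ^ e - 1) := by
    rw [inv_eq_iff_mul_eq_one, ← pow_succ', Nat.sub_add_cancel hpos, hα, genX_pow]
  have conj : ∀ i : ℕ, ∀ m ∈ Subgroup.zpowers β, (α ^ i)⁻¹ * m * α ^ i ∈ Subgroup.zpowers β := by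
    intro i
    induction i with
    | zero => intro m hm; simpa using hm
    | succ i ih =>
      rintro _ ⟨k, rfl⟩
      have h1 : α⁻¹ * β ^ k * α ∈ Subgroup.zpowers β := by
        have : α⁻¹ * β ^ k * α = (α⁻¹ * β * α) ^ k := by
          have := conj_zpow (a := α⁻¹) (b := β) (i := k)
          rw [inv_inv] at this
          exact this.symm
        rw [this, hα, hβ, genX_inv_mul_genZ_mul_genX]
        exact zpow_mem (pow_mem (Subgroup.mem_zpowers _) _) _
      have h2 := ih _ h1
      convert h2 using 1
      change (α ^ (i + 1))⁻¹ * β ^ k * α ^ (i + 1) = _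
      rw [pow_succ']; group
  have key : ∃ i : ℕ, ∃ m ∈ Subgroup.zpowers β, a = α ^ i * m := by
    have ha : a ∈ Subgroup.closure (Set.range (PresentedGroup.of (rels := metacyclicRels p e f))) := by
      rw [PresentedGroup.closure_range_of]; trivial
    induction ha using Subgroup.closure_induction_left with
    | one => exact ⟨0, 1, one_mem _, by simp⟩
    | mul_left s hs y hy ih =>
      obtain ⟨i, m, hm, rfl⟩ := ih
      obtain ⟨t, rfl⟩ := hs
      fin_cases t
      · exact ⟨i + 1, m, hm, by rw [pow_succ', mul_assoc]; rfl⟩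
      · refine ⟨i, (α ^ i)⁻¹ * β * α ^ i * m, mul_mem (conj i _ (Subgroup.mem_zpowers _)) hm, ?_⟩
        change β * _ = _
        group
    | inv_mul_cancel s hs y hy ih =>
      obtain ⟨i, m, hm, rfl⟩ := ih
      obtain ⟨t, rfl⟩ := hs
      fin_cases t
      · refine ⟨p ^ e - 1 + i, m, hm, ?_⟩
        change α⁻¹ * _ = _
        rw [hαinv, pow_add, mul_assoc]
      · refine ⟨i, (α ^ i)⁻¹ * β⁻¹ * α ^ i * m,
          mul_mem (conj i _ (inv_mem (Subgroup.mem_zpowers _))) hm, ?_⟩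
        change β⁻¹ * _ = _
        group
  obtain ⟨i, m, ⟨j, rfl⟩, rfl⟩ := key
  exact ⟨i, j, by rw [zpow_natCast]⟩

theorem card_le_of_forall_eq {G : Type*} [Group G] {a b : G} {m n : ℕ} (hm : 0 < m) (hn : 0 < n)
    (ha : a ^ m = 1) (hb : b ^ n = 1) (h : ∀ g : G, ∃ i j : ℤ, g = a ^ i * b ^ j) :
    Finite G ∧ Nat.card G ≤ m * n := by
  have hfa : Finite (Subgroup.zpowers a) :=
    finite_zpowers.2 (isOfFinOrder_iff_pow_eq_one.2 ⟨m, hm, ha⟩)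
  have hfb : Finite (Subgroup.zpowers b) :=
    finite_zpowers.2 (isOfFinOrder_iff_pow_eq_one.2 ⟨n, hn, hb⟩)
  have hsurj : Function.Surjective
      (fun q : Subgroup.zpowers a × Subgroup.zpowers b => (q.1 : G) * (q.2 : G)) := by
    intro g
    obtain ⟨i, j, rfl⟩ := h g
    exact ⟨(⟨a ^ i, i, rfl⟩, ⟨b ^ j, j, rfl⟩), rfl⟩
  refine ⟨Finite.of_surjective _ hsurj, (Nat.card_le_card_of_surjective _ hsurj).trans ?_⟩
  rw [Nat.card_prod, Nat.card_zpowers, Nat.card_zpowers]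
  exact Nat.mul_le_mul (orderOf_le_of_pow_eq_one hm ha) (orderOf_le_of_pow_eq_one hn hb)

/-- The group with parameter `f' ≤ e` maps onto the abelian group `ℤ/p^e × ℤ/p^f'`. In an abelian
image of the group with parameter `f`, the relation forces `z ^ p ^ f = 1`, so the image has order
at most `p ^ e * p ^ f`. -/
theorem le_of_mulEquiv [hp : Fact p.Prime] {f' : ℕ} (hf' : f' ≤ e)
    (φ : MetacyclicGroup p e f ≃* MetacyclicGroup p e f') : f' ≤ f := by
  have hpos : ∀ n, 0 < p ^ n := pow_pos hp.out.pos
  let A := Multiplicative (ZMod (p ^ e)) × Multiplicative (ZMod (p ^ f'))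
  have hord : ∀ n (t : Multiplicative (ZMod (p ^ n))), t ^ p ^ n = 1 := by
    intro n t
    apply Multiplicative.toAdd.injective
    rw [toAdd_pow, toAdd_one, nsmul_eq_mul, ZMod.natCast_self, zero_mul]
  let s : A := (Multiplicative.ofAdd 1, 1)
  let z : A := (1, Multiplicative.ofAdd 1)
  obtain ⟨ψ, hψ1, hψ2⟩ := exists_hom (p := p) (e := e) (f := f') (s := s) (z := z)
    (Prod.ext (hord e _) (one_pow _))
    (Prod.ext (one_pow _) (by
      obtain ⟨k, hk⟩ := pow_dvd_pow p hf'
      change (Multiplicative.ofAdd (1 : ZMod (p ^ f'))) ^ p ^ e = 1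
      rw [hk, pow_mul, hord, one_pow]))
    (by
      rw [mul_comm, mul_inv_cancel_left, pow_add, pow_one]
      have : z ^ p ^ f' = 1 := Prod.ext (one_pow _) (hord f' _)
      rw [this, mul_one])
  have hψ : Function.Surjective ψ := by
    rintro ⟨a, b⟩
    obtain ⟨i, hi⟩ := ZMod.intCast_surjective a.toAdd
    obtain ⟨j, hj⟩ := ZMod.intCast_surjective b.toAdd
    refine ⟨genX p e f' ^ i * genZ p e f' ^ j, ?_⟩
    rw [map_mul, map_zpow, map_zpow, hψ1, hψ2]
    refine Prod.ext ?_ ?_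
    · change (Multiplicative.ofAdd (1 : ZMod (p ^ e))) ^ i * 1 ^ j = a
      rw [one_zpow, mul_one, ← ofAdd_zsmul, zsmul_one, hi]; rfl
    · change 1 ^ i * (Multiplicative.ofAdd (1 : ZMod (p ^ f'))) ^ j = b
      rw [one_zpow, one_mul, ← ofAdd_zsmul, zsmul_one, hj]; rfl
  let θ : MetacyclicGroup p e f →* A := ψ.comp φ.toMonoidHom
  have hθ : Function.Surjective θ := hψ.comp φ.surjective
  have hx : θ (genX p e f) ^ p ^ e = 1 := by rw [← map_pow, genX_pow, map_one]
  have hz : θ (genZ p e f) ^ p ^ f = 1 := by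
    have := congrArg θ (genX_inv_mul_genZ_mul_genX p e f)
    rw [map_mul, map_mul, map_inv, map_pow, mul_comm, mul_inv_cancel_left, pow_add, pow_one] at this
    exact left_eq_mul.1 this
  have hA := (card_le_of_forall_eq (hpos e) (hpos f) hx hz (by
    intro a
    obtain ⟨b, rfl⟩ := hθ a
    obtain ⟨i, j, rfl⟩ := exists_eq b
    exact ⟨i, j, by rw [map_mul, map_zpow, map_zpow]⟩)).2
  have hcard : Nat.card A = p ^ e * p ^ f' := by
    rw [Nat.card_prod]
    congr 1
    · exact Nat.card_zmod _
    · exact Nat.card_zmod _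
  rw [hcard] at hA
  exact (Nat.pow_le_pow_iff_right hp.out.one_lt).1 (Nat.le_of_mul_le_mul_left hA (hpos e))

theorem eq_of_mulEquiv [Fact p.Prime] {f' : ℕ} (hf : f ≤ e) (hf' : f' ≤ e)
    (φ : MetacyclicGroup p e f ≃* MetacyclicGroup p e f') : f = f' :=
  le_antisymm (le_of_mulEquiv hf φ.symm) (le_of_mulEquiv hf' φ)

/-- The relations give a homomorphism onto `H`. The normal form bounds the presented group by `p ^
(2 * e)`, the order of `H`, so it is bijective. -/
theorem nonempty_mulEquiv [hp : Fact p.Prime] {G : Type*} [Group G] {H : Subgroup G} {x y s z : G}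
    (hH : IsBicyclic p e H x y) (hsH : s ∈ H) (hzH : z ∈ H) (hs : s ^ p ^ e = 1)
    (hz : z ^ p ^ e = 1) (hsz : s⁻¹ * z * s = z ^ (1 + p ^ f))
    (hx : x ∈ Subgroup.closure {s, z}) (hy : y ∈ Subgroup.closure {s, z}) :
    Nonempty (H ≃* MetacyclicGroup p e f) := by
  obtain ⟨φ, hφs, hφz⟩ := exists_hom (p := p) (e := e) (f := f) (s := (⟨s, hsH⟩ : H))
    (z := (⟨z, hzH⟩ : H)) (Subtype.ext hs) (Subtype.ext hz) (Subtype.ext hsz)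
  have hle : H ≤ φ.range.map H.subtype := by
    have h1 : Subgroup.closure {s, z} ≤ φ.range.map H.subtype := by
      rw [Subgroup.closure_le]
      rintro _ (rfl | rfl)
      · exact ⟨_, ⟨_, hφs⟩, rfl⟩
      · exact ⟨_, ⟨_, hφz⟩, rfl⟩
    intro a ha
    obtain ⟨i, j, rfl⟩ := hH.exists_eq a ha
    exact mul_mem (zpow_mem (h1 hx) _) (zpow_mem (h1 hy) _)
  have hsurj : Function.Surjective φ := by
    intro a
    obtain ⟨b, hb, hba⟩ := hle a.2
    obtain ⟨t, rfl⟩ := hb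
    exact ⟨t, Subtype.ext hba⟩
  have hpos := pow_pos hp.out.pos e
  obtain ⟨hfin, hcard⟩ := card_le_of_forall_eq hpos hpos (genX_pow p e f) (genZ_pow p e f) exists_eq
  have hbij : Function.Bijective φ := hsurj.bijective_of_nat_card_le (by
    rw [hH.card_eq]; refine hcard.trans (le_of_eq ?_); ring)
  exact ⟨(MulEquiv.ofBijective φ hbij).symm⟩

end MetacyclicGroup

/-! ### Recognizing `H` from a central commutator in the last layer. -/

theorem mem_of_zpow_mem_of_not_dvd {G : Type*} [Group G] {p e : ℕ} [hp : Fact p.Prime]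
    {K : Subgroup G} {a : G} (ha : a ^ p ^ e = 1) {k : ℤ} (hk : ¬ (p : ℤ) ∣ k) (h : a ^ k ∈ K) :
    a ∈ K := by
  obtain ⟨u, v, huv⟩ :=
    (((Nat.prime_iff_prime_int.1 hp.out).coprime_iff_not_dvd.2 hk).pow_left (m := e))
  have : a = (a ^ k) ^ v := by
    calc a = a ^ (u * (p : ℤ) ^ e + v * k) := by rw [huv, zpow_one]
      _ = _ := by
        rw [zpow_add, mul_comm u, mul_comm v, zpow_mul, zpow_mul, ← Nat.cast_pow, zpow_natCast, ha,
          one_zpow, one_mul]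
  rw [this]
  exact zpow_mem h v

namespace IsBicyclic

variable {G : Type*} [Group G] {p e : ℕ} {H : Subgroup G} {x y c : G}

theorem pow_left (hH : IsBicyclic p e H x y) : x ^ p ^ e = 1 := by
  rw [← hH.orderOf_left, pow_orderOf_eq_one]

theorem pow_right (hH : IsBicyclic p e H x y) : y ^ p ^ e = 1 := by
  rw [← hH.orderOf_right, pow_orderOf_eq_one]

theorem zpow_eq_of_dvd_sub_one (hcp : c ^ p = 1) {k : ℤ} (hk : (p : ℤ) ∣ k - 1) : c ^ k = c := by
  obtain ⟨m, hm⟩ := hk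
  rw [show k = p * m + 1 by omega, zpow_add, zpow_mul, zpow_natCast, hcp, one_zpow, one_mul,
    zpow_one]

variable [hp : Fact p.Prime]

theorem exists_mul_sub_one_dvd {b : ℤ} (hb : ¬ (p : ℤ) ∣ b) :
    ∃ k : ℤ, (p : ℤ) ∣ k * b - 1 ∧ ¬ (p : ℤ) ∣ k := by
  obtain ⟨u, v, huv⟩ := (Nat.prime_iff_prime_int.1 hp.out).coprime_iff_not_dvd.2 hb
  have h1 : (p : ℤ) ∣ v * b - 1 := ⟨-u, by linear_combination huv⟩
  refine ⟨v, h1, fun h => ?_⟩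
  have h2 : (p : ℤ) ∣ 1 := by
    have := dvd_sub (h.mul_right b) h1
    simpa using this
  exact hp.out.one_lt.ne' (by exact_mod_cast Int.eq_one_of_dvd_one (by positivity) h2)

/-- Lifting the exponents of `c` from `H_{e-1}` to `H` gives `z` with `z ^ p ^ (e - 1) = c`.
Conjugation by a power of `x` or `y` multiplies `z` by a power of `c`, and that power can be
normalized to `c` itself. -/
theorem nonempty_mulEquiv_metacyclicGroup (hp2 : p ≠ 2) (he : 2 ≤ e) (hH : IsBicyclic p e H x y)
    (hc : c = ⁅x, y⁆) (hcx : Commute c x) (hcy : Commute c y) (hc1 : c ≠ 1)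
    (hcmem : c ∈ agemoIter p H (e - 1)) :
    Nonempty (H ≃* MetacyclicGroup p e (e - 1)) := by
  have hxy : x * y = c * (y * x) := by rw [hc, commutatorElement_def]; group
  have hpe : p ^ e = p ^ (e - 1) * p := by rw [← pow_succ]; congr 1; omega
  obtain ⟨a, b, hab⟩ := (hH.iterate (i := e - 1) (k := 1) (by omega)).exists_eq c hcmem
  have hcp : c ^ p = 1 := by
    have h1 := pow_mem_agemoIter_succ hcmem
    rw [Nat.sub_add_cancel (by omega)] at h1
    have h2 := (hH.iterate (i := e) (k := 0) (by omega)).card_eq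
    rw [mul_zero, pow_zero, Subgroup.card_eq_one] at h2
    rwa [h2, Subgroup.mem_bot] at h1
  have hzc : (x ^ a * y ^ b) ^ p ^ (e - 1) = c := by
    have h2p : 2 ≠ p ^ (e - 1) := fun h => hp2
      ((Nat.prime_dvd_prime_iff_eq hp.out Nat.prime_two).1 (h ▸ dvd_pow_self p (by omega)))
    obtain ⟨k, hk⟩ := hp.out.dvd_choose_pow (n := e - 1) (k := 2) (by norm_num) h2p
    rw [mul_pow_of_commutes hxy hcx hcy, hk,
      show -(a * b * ((p * k : ℕ) : ℤ)) = (p : ℤ) * (-(a * b * k)) by push_cast; ring, zpow_mul c,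
      zpow_natCast c, hcp, one_zpow, mul_one, mul_comm a, mul_comm b, zpow_mul, zpow_mul,
      zpow_natCast, zpow_natCast, ← hab]
  set z := x ^ a * y ^ b with hz
  have hzH : z ∈ H := mul_mem (zpow_mem hH.mem_left _) (zpow_mem hH.mem_right _)
  have hzp : z ^ p ^ e = 1 := by rw [hpe, pow_mul, hzc, hcp]
  have cc : ∀ i j k : ℤ, Commute (c ^ i) (x ^ j * y ^ k) := fun i j k =>
    ((hcx.zpow_right j).mul_right (hcy.zpow_right k)).zpow_left _
  -- Since `c ≠ 1`, one of `a`, `b` is prime to `p`. Conjugation by the opposite generator then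
  -- moves `z`, and `k`, the inverse of that exponent modulo `p`, makes the factor exactly `c`.
  by_cases hb : (p : ℤ) ∣ b
  · have ha : ¬ (p : ℤ) ∣ a := by
      rintro ⟨a', rfl⟩
      obtain ⟨b', rfl⟩ := hb
      apply hc1
      rw [hab, zpow_mul, zpow_mul, zpow_natCast, zpow_natCast, ← pow_mul, ← pow_mul, ← hpe,
        hH.pow_left, hH.pow_right, one_zpow, one_zpow, mul_one]
    obtain ⟨k, hk1, hk2⟩ := exists_mul_sub_one_dvd ha
    have hyk : y ∈ Subgroup.closure {y ^ k, z} := mem_of_zpow_mem_of_not_dvd hH.pow_right hk2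
      (Subgroup.subset_closure (Set.mem_insert _ _))
    refine MetacyclicGroup.nonempty_mulEquiv hH (zpow_mem hH.mem_right k) hzH ?_ hzp ?_ ?_ hyk
    · rw [← zpow_natCast, ← zpow_mul, mul_comm, zpow_mul, zpow_natCast, hH.pow_right, one_zpow]
    · have h1 := zpow_mul_zpow_eq_of_commutes hxy hcx hcy k a
      calc (y ^ k)⁻¹ * z * y ^ k = (y ^ k)⁻¹ * (x ^ a * y ^ k) * y ^ b := by
            rw [hz]; group
        _ = x ^ a * (c ^ (a * k) * y ^ b) := by rw [h1]; group
        _ = z * c ^ (a * k) := by rw [((hcy.zpow_right b).zpow_left _).eq, hz, mul_assoc]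
        _ = _ := by
          rw [zpow_eq_of_dvd_sub_one hcp (by rwa [mul_comm]), pow_add, pow_one, hzc]
    · refine mem_of_zpow_mem_of_not_dvd hH.pow_left ha ?_
      exact (Subgroup.mul_mem_cancel_right _ (zpow_mem hyk b)).1
        (Subgroup.subset_closure (Set.mem_insert_of_mem _ rfl))
  · obtain ⟨k, hk1, hk2⟩ := exists_mul_sub_one_dvd hb
    have hk3 : ¬ (p : ℤ) ∣ -k := fun h => hk2 (Int.dvd_neg.1 h)
    have hxk : x ∈ Subgroup.closure {x ^ (-k), z} := mem_of_zpow_mem_of_not_dvd hH.pow_left hk3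
      (Subgroup.subset_closure (Set.mem_insert _ _))
    refine MetacyclicGroup.nonempty_mulEquiv hH (zpow_mem hH.mem_left (-k)) hzH ?_ hzp ?_ hxk ?_
    · rw [← zpow_natCast, ← zpow_mul, mul_comm, zpow_mul, zpow_natCast, hH.pow_left, one_zpow]
    · have h1 := zpow_mul_zpow_eq_of_commutes hxy hcx hcy b k
      calc (x ^ (-k))⁻¹ * z * x ^ (-k) = x ^ a * (x ^ k * y ^ b) * x ^ (-k) := by
            rw [hz, zpow_neg, inv_inv, ← mul_assoc, ← mul_assoc, ← zpow_add, ← zpow_add, add_comm]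
        _ = x ^ a * y ^ b * x ^ k * (c ^ (k * b) * x ^ (-k)) := by rw [h1]; group
        _ = z * c ^ (k * b) := by rw [((hcx.zpow_right (-k)).zpow_left _).eq, hz]; group
        _ = _ := by rw [zpow_eq_of_dvd_sub_one hcp hk1, pow_add, pow_one, hzc]
    · refine mem_of_zpow_mem_of_not_dvd hH.pow_right hb ?_
      exact (Subgroup.mul_mem_cancel_left _ (zpow_mem hxk a)).1
        (Subgroup.subset_closure (Set.mem_insert_of_mem _ rfl))

/-- The purely group-theoretic form of the theorem. Noncommutativity gives `c ≠ 1`; as `c ∈ H_1`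
always and `H_e` is trivial, `e = 1` is impossible. -/
theorem eq_three_and_nonempty_mulEquiv {P : Type*} [Group P] [Finite P] {H : Subgroup P}
    [H.Normal] {x g : P} (hP : IsPGroup p P) (hH : IsBicyclic p e H x (g * x * g⁻¹)) (hp2 : p ≠ 2)
    (he : 1 ≤ e) (hgH : g ^ p ∈ H) (hg : g ^ p ^ e = 1)
    (hcomm : ¬ ∀ a ∈ H, ∀ b ∈ H, Commute a b) :
    p = 3 ∧ 2 ≤ e ∧ Nonempty (H ≃* MetacyclicGroup p e (e - 1)) := by
  have hbot : agemoIter p H e = ⊥ := hH.agemoIter_self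
  have hc1 : ⁅x, g * x * g⁻¹⁆ ≠ 1 := by
    intro h
    refine hcomm fun a ha b hb => ?_
    have h1 := hH.commute_of_commute (N := ⊥)
      (commute_mk_iff.2 (Subgroup.mem_bot.2 h)) ha hb
    rw [commute_mk_iff, Subgroup.mem_bot] at h1
    exact commutatorElement_eq_one_iff_mul_comm.1 h1
  have hc0 : ⁅x, g * x * g⁻¹⁆ ∈ agemoIter p H 1 :=
    commute_mk_iff.1 (hH.commute_mk hP (i := 0) (by omega) hH.mem_right hH.mem_left)
  have he2 : 2 ≤ e := by
    by_contra h
    obtain rfl : e = 1 := by omega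
    rw [hbot] at hc0
    exact hc1 hc0
  -- The bound on the exponent of `P` enters only here: `g ^ p` has order dividing `p ^ (e - 1)`.
  have hgp : g ^ p ∈ agemoIter p H 1 := by
    refine hH.mem_agemoIter_one_of_pow_eq_one hP hp2 he hgH ?_
    rw [← pow_mul, ← pow_succ', Nat.sub_add_cancel he, hg]
  have hp3 := (hH.eq_three_and_notMem hP hp2 hgp (i := 0) he2 rfl rfl rfl rfl).2.2.1
  have hce := hH.commutator_mem_agemoIter hP hp2 hgp he2
  have hcH : ∀ h ∈ H, Commute ⁅x, g * x * g⁻¹⁆ h := by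
    intro h hh
    have h1 := hH.commute_mk hP (i := e - 1) (by omega) hce hh
    rw [commute_mk_iff, Nat.sub_add_cancel he, hbot, Subgroup.mem_bot] at h1
    exact (commutatorElement_eq_one_iff_mul_comm.1 h1).symm
  exact ⟨hp3, he2, hH.nonempty_mulEquiv_metacyclicGroup hp2 he2 rfl (hcH _ hH.mem_left)
    (hcH _ hH.mem_right) hc1 hce⟩

end IsBicyclic

/-! ### Automorphism groups of orientably-regular maps. -/

namespace OrientedMap

section General

variable {V : Type*} {Γ : SimpleGraph V} {M : OrientedMap Γ}

theorem IsOrientablyRegular.eq_of_mapDart_eq (hM : M.IsOrientablyRegular) {φ ψ : M.autPlus}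
    (d : Γ.Dart) (h : φ.val.toHom.mapDart d = ψ.val.toHom.mapDart d) : φ = ψ :=
  (hM d _).unique h rfl

theorem IsOrientablyRegular.eq_of_apply_eq (hM : M.IsOrientablyRegular) {φ ψ : M.autPlus}
    {v w : V} (hvw : Γ.Adj v w) (hv : φ.val v = ψ.val v) (hw : φ.val w = ψ.val w) : φ = ψ :=
  hM.eq_of_mapDart_eq ⟨(v, w), hvw⟩ (SimpleGraph.Dart.ext _ _ (Prod.ext hv hw))

theorem IsOrientablyRegular.card_autPlus (hM : M.IsOrientablyRegular) (d : Γ.Dart) :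
    Nat.card M.autPlus = Nat.card Γ.Dart :=
  Nat.card_eq_of_bijective (fun φ : M.autPlus => φ.val.toHom.mapDart d)
    ⟨fun _ _ h => hM.eq_of_mapDart_eq d h, fun d' => (hM d d').exists⟩

/-- The stabilizer of a vertex in the automorphism group of an orientably-regular map is cyclic. -/
theorem IsOrientablyRegular.exists_forall_eq_zpow (hM : M.IsOrientablyRegular) {v w : V}
    (hvw : Γ.Adj v w) : ∃ R : M.autPlus, ∀ φ : M.autPlus, φ.val v = v → ∃ k : ℤ, φ = R ^ k := by
  let d : Γ.Dart := ⟨(v, w), hvw⟩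
  obtain ⟨R, hR, -⟩ := hM d (M.rot d)
  have hcomm : ∀ (φ : M.autPlus) (d : Γ.Dart),
      φ.val.toHom.mapDart (M.rot d) = M.rot (φ.val.toHom.mapDart d) := fun φ => φ.2
  -- `R` is chosen to agree with `rot` at the base arc `d` alone; since automorphisms commute with
  -- `rot`, the powers agree at `d` too.
  have hnat : ∀ k : ℕ, (R ^ k).val.toHom.mapDart d = (M.rot ^ k) d := by
    intro k
    induction k with
    | zero => rfl
    | succ k ih =>
      have h1 : (R ^ (k + 1)).val.toHom.mapDart d
          = (R ^ k).val.toHom.mapDart (R.val.toHom.mapDart d) := by rw [pow_succ]; rfl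
      rw [h1]
      rw [hR, hcomm, ih, pow_succ', Equiv.Perm.mul_apply]
  have hint : ∀ k : ℤ, (R ^ k).val.toHom.mapDart d = (M.rot ^ k) d := by
    have hrot : ∀ (φ : M.autPlus) (k : ℕ) (d : Γ.Dart),
        φ.val.toHom.mapDart ((M.rot ^ k) d) = (M.rot ^ k) (φ.val.toHom.mapDart d) := by
      intro φ k
      induction k with
      | zero => intro d; rfl
      | succ k ih =>
        intro d
        rw [pow_succ, Equiv.Perm.mul_apply, Equiv.Perm.mul_apply, ih, hcomm]
    intro k
    obtain ⟨k, rfl | rfl⟩ := k.eq_nat_or_neg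
    · rw [zpow_natCast, zpow_natCast]; exact hnat k
    · rw [zpow_neg, zpow_neg, zpow_natCast, zpow_natCast, Equiv.Perm.eq_inv_iff_eq, ← hrot, ← hnat]
      exact SimpleGraph.Dart.ext _ _ (Prod.ext ((R ^ k).val.symm_apply_apply _)
        ((R ^ k).val.symm_apply_apply _))
  refine ⟨R, fun φ hφ => ?_⟩
  obtain ⟨k, hk⟩ := M.rot_cyclic d (φ.val.toHom.mapDart d) hφ.symm
  exact ⟨k, hM.eq_of_mapDart_eq d (by rw [hint, hk])⟩

end General

section Multipartite

variable {m n : ℕ} {M : OrientedMap (SimpleGraph.completeEquipartiteGraph m n)}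

theorem fst_eq_iff (φ : M.autPlus) (u v : Fin m × Fin n) :
    (φ.val u).1 = (φ.val v).1 ↔ u.1 = v.1 := by
  have := φ.val.map_rel_iff (a := u) (b := v)
  rw [SimpleGraph.completeEquipartiteGraph_adj, SimpleGraph.completeEquipartiteGraph_adj] at this
  exact not_iff_not.1 this

theorem mem_autPlusZero {φ : M.autPlus} : φ ∈ M.autPlusZero ↔ ∀ v, (φ.val v).1 = v.1 := Iff.rfl

/-- The action on the set of parts. -/
def partPerm (M : OrientedMap (SimpleGraph.completeEquipartiteGraph m n)) (t : Fin n) :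
    M.autPlus →* Equiv.Perm (Fin m) :=
  MonoidHom.toHomPerm
    { toFun := fun φ i => (φ.val (i, t)).1
      map_one' := rfl
      map_mul' := fun φ ψ => funext fun i =>
        (fst_eq_iff φ (ψ.val (i, t)) ((ψ.val (i, t)).1, t)).2 rfl }

theorem ker_partPerm (t : Fin n) : (partPerm M t).ker = M.autPlusZero := by
  ext φ
  rw [MonoidHom.mem_ker, mem_autPlusZero]
  constructor
  · intro h v
    have h1 : (φ.val (v.1, t)).1 = v.1 := congrArg (fun σ : Equiv.Perm (Fin m) => σ v.1) h
    rw [← h1]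
    exact ((fst_eq_iff φ _ _).2 rfl)
  · intro h
    ext i
    exact congrArg Fin.val (h (i, t))

instance autPlusZero_normal : M.autPlusZero.Normal := by
  rcases n.eq_zero_or_pos with rfl | hn
  · refine ⟨fun φ _ ψ v => v.2.elim0⟩
  · rw [← ker_partPerm ⟨0, hn⟩]
    infer_instance

theorem card_dart (m n : ℕ) : Nat.card (SimpleGraph.completeEquipartiteGraph m n).Dart
    = m * (m - 1) * n ^ 2 := by
  rw [Nat.card_eq_fintype_card, SimpleGraph.dart_card_eq_twice_card_edges,
    SimpleGraph.card_edgeFinset_completeEquipartiteGraph, ← mul_assoc, mul_comm 2,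
    Nat.choose_two_right, Nat.div_mul_cancel (Nat.even_mul_pred_self m).two_dvd]

end Multipartite

end OrientedMap

namespace OrientedMap

/-- An element of `H` is determined by the images of two adjacent vertices, each confined to its
part, which bounds `|H|` above. Conversely `G / H` embeds in the symmetric group on `p` parts, whose
order contains only one factor `p`. -/
theorem card_autPlusZero {p e : ℕ} [hp : Fact p.Prime]
    {M : OrientedMap (SimpleGraph.completeEquipartiteGraph p (p ^ e))}
    (hM : M.IsOrientablyRegular) : Nat.card M.autPlusZero = p ^ (2 * e) ∧
      Nat.card M.autPlus = p ^ (2 * e + 1) * (p - 1) := by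
  have hpos : 0 < p ^ e := pow_pos hp.out.pos e
  have := hp.out.two_le
  let t : Fin (p ^ e) := ⟨0, hpos⟩
  have hvw : (SimpleGraph.completeEquipartiteGraph p (p ^ e)).Adj
      (⟨0, by omega⟩, t) (⟨1, by omega⟩, t) := by
    rw [SimpleGraph.completeEquipartiteGraph_adj]; simp
  set v : Fin p × Fin (p ^ e) := (⟨0, by omega⟩, t)
  set w : Fin p × Fin (p ^ e) := (⟨1, by omega⟩, t)
  have hG : Nat.card M.autPlus = p ^ (2 * e + 1) * (p - 1) := by
    rw [hM.card_autPlus ⟨(v, w), hvw⟩, card_dart]; ring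
  refine ⟨le_antisymm ?_ (Nat.le_of_dvd ?_ ?_), hG⟩
  · have hinj : Function.Injective
        (fun φ : M.autPlusZero => (((φ.val).val v).2, ((φ.val).val w).2)) := by
      intro φ ψ h
      apply Subtype.ext
      refine hM.eq_of_apply_eq hvw (Prod.ext ?_ (Prod.ext_iff.1 h).1)
        (Prod.ext ?_ (Prod.ext_iff.1 h).2)
      · rw [mem_autPlusZero.1 φ.2, mem_autPlusZero.1 ψ.2]
      · rw [mem_autPlusZero.1 φ.2, mem_autPlusZero.1 ψ.2]
    refine (Nat.card_le_card_of_injective _ hinj).trans (le_of_eq ?_)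
    rw [Nat.card_prod, Nat.card_fin, ← pow_add, two_mul]
  · have : Finite M.autPlus := Nat.finite_of_card_ne_zero (by
      rw [hG]; exact mul_ne_zero (pow_ne_zero _ hp.out.ne_zero) (by omega))
    exact Nat.card_pos
  · have h1 := (partPerm M t).ker.index_mul_card
    rw [Subgroup.index_ker, ker_partPerm, hG] at h1
    have h2 : Nat.card (partPerm M t).range ∣ p.factorial := by
      have := (partPerm M t).range.card_subgroup_dvd_card
      rwa [Nat.card_perm, Nat.card_fin] at this
    have h3 : p * p ^ (2 * e) ∣ p * ((p - 1).factorial * Nat.card M.autPlusZero) := by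
      rw [← mul_assoc, Nat.mul_factorial_pred hp.out.ne_zero, ← pow_succ']
      exact (Dvd.intro _ h1.symm).trans (mul_dvd_mul_right h2 _)
    refine Nat.Coprime.dvd_of_dvd_mul_left ?_ (Nat.dvd_of_mul_dvd_mul_left hp.out.pos h3)
    exact ((Nat.coprime_factorial_iff (by omega)).2 (by rw [hp.out.minFac_eq]; omega)).pow_left _

/-- By the order count `H` acts regularly on pairs of vertices from the parts of `v` and `w = g v`.
The stabilizers of `v` and `w` in `H` are therefore cyclic of order `p ^ e`, conjugate under `g`,
and meet trivially; correcting `h` by an `a` that fixes `v` and agrees with `h` at `w` factors `h`.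
-/
theorem exists_isBicyclic {p e : ℕ} [hp : Fact p.Prime]
    {M : OrientedMap (SimpleGraph.completeEquipartiteGraph p (p ^ e))}
    (hM : M.IsOrientablyRegular) {g : M.autPlus} (hg : g ∉ M.autPlusZero) :
    ∃ x, IsBicyclic p e M.autPlusZero x (g * x * g⁻¹) := by
  set H := M.autPlusZero
  have hn : H.Normal := autPlusZero_normal
  obtain ⟨hcard, -⟩ := card_autPlusZero hM
  obtain ⟨v, hv⟩ : ∃ v, (g.val v).1 ≠ v.1 := by
    by_contra! h
    exact hg h
  set w := g.val v with hw
  have hvw : (SimpleGraph.completeEquipartiteGraph p (p ^ e)).Adj v w := by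
    rw [SimpleGraph.completeEquipartiteGraph_adj]; exact hv.symm
  have hfin : Finite H := Nat.finite_of_card_ne_zero (by
    rw [hcard]; exact pow_ne_zero _ hp.out.ne_zero)
  let F : H → Fin (p ^ e) × Fin (p ^ e) := fun φ => ((φ.val.val v).2, (φ.val.val w).2)
  have hF : Function.Bijective F := by
    apply Function.Injective.bijective_of_nat_card_le
    · intro φ ψ h
      apply Subtype.ext
      refine hM.eq_of_apply_eq hvw (Prod.ext ?_ (Prod.ext_iff.1 h).1)
        (Prod.ext ?_ (Prod.ext_iff.1 h).2)
      · rw [mem_autPlusZero.1 φ.2, mem_autPlusZero.1 ψ.2]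
      · rw [mem_autPlusZero.1 φ.2, mem_autPlusZero.1 ψ.2]
    · rw [hcard, Nat.card_prod, Nat.card_fin, ← pow_add, two_mul]
  have hex : ∀ i j, ∃ φ ∈ H, φ.val v = (v.1, i) ∧ φ.val w = (w.1, j) := by
    intro i j
    obtain ⟨φ, hφ⟩ := hF.surjective (i, j)
    exact ⟨φ, φ.2, Prod.ext (φ.2 v) (Prod.ext_iff.1 hφ).1, Prod.ext (φ.2 w) (Prod.ext_iff.1 hφ).2⟩
  let S : Subgroup M.autPlus :=
    { carrier := {φ | φ ∈ H ∧ φ.val v = v}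
      one_mem' := ⟨one_mem _, rfl⟩
      mul_mem' := by
        rintro φ ψ ⟨h1, h2⟩ ⟨h3, h4⟩
        refine ⟨mul_mem h1 h3, ?_⟩
        change φ.val (ψ.val v) = v
        rw [h4, h2]
      inv_mem' := by
        rintro φ ⟨h1, h2⟩
        refine ⟨inv_mem h1, ?_⟩
        change φ.val.symm v = v
        nth_rewrite 1 [← h2]
        exact φ.val.symm_apply_apply v }
  obtain ⟨R, hR⟩ := hM.exists_forall_eq_zpow hvw
  have hScyc : IsCyclic S := by
    refine Subgroup.isCyclic_of_le (H' := Subgroup.zpowers R) fun φ hφ => ?_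
    obtain ⟨k, rfl⟩ := hR φ hφ.2
    exact ⟨k, rfl⟩
  obtain ⟨x, hx⟩ := (Subgroup.isCyclic_iff_exists_zpowers_eq_top S).1 hScyc
  have hxS : x ∈ S := by rw [← hx]; exact Subgroup.mem_zpowers x
  have hSG : ∀ a b : M.autPlus, a.val v = b.val v → a.val w = b.val w → a = b := fun a b h1 h2 =>
    hM.eq_of_apply_eq hvw h1 h2
  have hScard : Nat.card S = p ^ e := by
    refine (Nat.card_eq_of_bijective (fun φ : S => (φ.val.val w).2) ⟨?_, ?_⟩).trans
      (Nat.card_fin (p ^ e))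
    · intro φ ψ h
      refine Subtype.ext (hSG _ _ (φ.2.2.trans ψ.2.2.symm) (Prod.ext ?_ h))
      rw [mem_autPlusZero.1 φ.2.1, mem_autPlusZero.1 ψ.2.1]
    · intro j
      obtain ⟨φ, h1, h2, h3⟩ := hex v.2 j
      exact ⟨⟨φ, h1, h2⟩, congrArg Prod.snd h3⟩
  have hord : orderOf x = p ^ e := by rw [← Nat.card_zpowers, hx, hScard]
  have hconj : ∀ b ∈ H, b.val w = w → ∃ j : ℤ, b = (g * x * g⁻¹) ^ j := by
    intro b hb hbw
    have h1 : g⁻¹ * b * g ∈ S := by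
      refine ⟨by simpa using hn.conj_mem b hb g⁻¹, ?_⟩
      change g.val.symm (b.val (g.val v)) = v
      rw [← hw, hbw, hw]
      exact g.val.symm_apply_apply v
    rw [← hx] at h1
    obtain ⟨j, hj⟩ := h1
    refine ⟨j, ?_⟩
    change x ^ j = _ at hj
    rw [conj_zpow, hj]
    group
  have hyw : ∀ j : ℤ, ((g * x * g⁻¹) ^ j).val w = w := by
    intro j
    have h1 : x ^ j ∈ S := zpow_mem hxS j
    rw [conj_zpow]
    change g.val ((x ^ j).val (g.val.symm (g.val v))) = w
    have h2 : g.val.symm (g.val v) = v := g.val.symm_apply_apply v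
    rw [h2, h1.2]
  refine ⟨x, hxS.1, hn.conj_mem _ hxS.1 g, hord, ?_, ?_, ?_⟩
  · exact ((MulAut.conj g).orderOf_eq x).trans hord
  · rw [Subgroup.disjoint_def]
    intro a ha hb
    rw [hx] at ha
    obtain ⟨j, rfl⟩ := hb
    exact hSG _ 1 ha.2 (hyw j)
  · intro h hh
    obtain ⟨a, h1, h2, h3⟩ := hex v.2 (h.val w).2
    have haS : a ∈ S := ⟨h1, h2⟩
    have h4 : a.val w = h.val w := h3.trans (Prod.ext (hh w).symm rfl)
    obtain ⟨j, hj⟩ := hconj (a⁻¹ * h) (mul_mem (inv_mem h1) hh) (by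
      change a.val.symm (h.val w) = w
      rw [← h4]
      exact a.val.symm_apply_apply w)
    rw [← hx] at haS
    obtain ⟨i, hi⟩ := haS
    refine ⟨i, j, ?_⟩
    change x ^ i = a at hi
    rw [hi, ← hj, mul_inv_cancel_left]

end OrientedMap

/-! ### Passage to the Sylow subgroup and conclusion. -/

theorem IsBicyclic.subgroupOf {G : Type*} [Group G] {p e : ℕ} {H K : Subgroup G} {x y : K}
    (h : IsBicyclic p e H (x : G) (y : G)) : IsBicyclic p e (H.subgroupOf K) x y where
  mem_left := h.mem_left
  mem_right := h.mem_right
  orderOf_left := by rw [← h.orderOf_left, Subgroup.orderOf_coe]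
  orderOf_right := by rw [← h.orderOf_right, Subgroup.orderOf_coe]
  disjoint := by
    rw [Subgroup.disjoint_def]
    rintro _ ⟨i, rfl⟩ ⟨j, hj⟩
    apply Subtype.ext
    exact Subgroup.disjoint_def.1 h.disjoint ⟨i, rfl⟩ ⟨j, congrArg Subtype.val hj⟩
  exists_eq a ha := by
    obtain ⟨i, j, hij⟩ := h.exists_eq a ha
    exact ⟨i, j, Subtype.ext hij⟩

theorem theorem3p4 (p e : ℕ) (hp : p.Prime) (hp3 : 3 ≤ p) (he : 1 ≤ e)
    (M : OrientedMap (SimpleGraph.completeEquipartiteGraph p (p ^ e)))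
    (hM : M.IsOrientablyRegular)
    (hH : ¬ ∀ g h : M.autPlusZero, g * h = h * g)
    (P : Sylow p M.autPlus) (hP : Monoid.exponent P = p ^ e) :
    p = 3 ∧ 2 ≤ e ∧
      Nonempty (M.autPlusZero ≃* MetacyclicGroup p e (e - 1)) ∧
      ∀ f : ℕ, 1 ≤ f → f ≤ e →
        Nonempty (M.autPlusZero ≃* MetacyclicGroup p e f) → f = e - 1 := by
  have : Fact p.Prime := ⟨hp⟩
  obtain ⟨hcard, hG⟩ := OrientedMap.card_autPlusZero hM
  have hcop : Nat.Coprime p (p - 1) := 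
    hp.coprime_iff_not_dvd.2 (Nat.not_dvd_of_pos_of_lt (by omega) (by omega))
  have hfin : Finite M.autPlus := Nat.finite_of_card_ne_zero (by
    rw [hG]; exact mul_ne_zero (pow_ne_zero _ hp.ne_zero) (by omega))
  have hn : M.autPlusZero.Normal := OrientedMap.autPlusZero_normal
  have hle : M.autPlusZero ≤ P :=
    (IsPGroup.of_card hcard).le_sylow_of_normal P
  have hPcard : Nat.card P = p ^ (2 * e + 1) := by
    refine Nat.dvd_antisymm ?_ (P.pow_dvd_card_of_pow_dvd_card (Dvd.intro _ hG.symm))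
    obtain ⟨m, hm⟩ := IsPGroup.iff_card.1 P.isPGroup'
    have h1 := Subgroup.card_subgroup_dvd_card (P : Subgroup M.autPlus)
    rw [hG] at h1
    refine Nat.Coprime.dvd_of_dvd_mul_right ?_ h1
    rw [hm]
    exact hcop.pow_left _
  -- Index `p` supplies both an element `g ∈ P` outside `H` and the membership `g ^ p ∈ H`.
  have hidx : (M.autPlusZero.subgroupOf P).index = p := by
    have h1 := (M.autPlusZero.subgroupOf P).index_mul_card
    rw [Nat.card_congr (Subgroup.subgroupOfEquivOfLe hle).toEquiv, hcard, hPcard, pow_succ'] at h1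
    exact Nat.eq_of_mul_eq_mul_right (pow_pos hp.pos _) h1
  obtain ⟨g, hgP, hg⟩ : ∃ g ∈ P, g ∉ M.autPlusZero := by
    by_contra! h
    have h1 : M.autPlusZero.subgroupOf P = ⊤ := Subgroup.subgroupOf_eq_top.2 h
    rw [h1, Subgroup.index_top] at hidx
    exact hp.one_lt.ne hidx
  obtain ⟨x, hx⟩ := OrientedMap.exists_isBicyclic hM hg
  let g' : P := ⟨g, hgP⟩
  let x' : P := ⟨x, hle hx.mem_left⟩
  have hx' : IsBicyclic p e (M.autPlusZero.subgroupOf P) x' (g' * x' * g'⁻¹) :=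
    IsBicyclic.subgroupOf hx
  have hgp : g' ^ p ∈ M.autPlusZero.subgroupOf P := by
    have := (M.autPlusZero.subgroupOf P).pow_index_mem g'
    rwa [hidx] at this
  obtain ⟨h1, h2, ⟨φ⟩⟩ := hx'.eq_three_and_nonempty_mulEquiv P.isPGroup' (by omega) he hgp
    (orderOf_dvd_iff_pow_eq_one.1 ((Monoid.order_dvd_exponent g').trans hP.dvd)) (fun h => hH fun a b => by
      have h3 := Subtype.ext_iff.1 (h ⟨a, hle a.2⟩ a.2 ⟨b, hle b.2⟩ b.2).eq
      exact Subtype.ext h3)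
  have ψ := (Subgroup.subgroupOfEquivOfLe hle).symm.trans φ
  exact ⟨h1, h2, ⟨ψ⟩, fun f _ hf ⟨θ⟩ =>
    MetacyclicGroup.eq_of_mulEquiv hf (by omega) (θ.symm.trans ψ)⟩
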